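/- **Theorem (Liveness).** Let $N,k,e,f$ be integers with $e,f\ge 0$ and $1\le k\le N-2(f+e)$ (so $1\le k\le N-2f$ when $e=0$). There are $N$ nodes $p_0,\dots,p_{N-1}$; each hosts a server and may host a client. Let $\Phi:A^k\to A^N$ be an $(N,k)$ MDS code (any $k$ coordinates of $\Phi(v)$ determine $v$), let $v_0\in A^k$ be the default value, let a quorum be a set of at least $\lceil (N+k+2e)/2\rceil$ servers, and let at most $e$ servers be malicious. Tags are pairs $(z,i)$, $z\in\mathbb Z^+$, $0\le i<N$, ordered lexicographically, and $t_0$ is an extra tag below all of them (with $z=0$). Consider the following algorithm (the unbounded self-stabilizing coded atomic storage algorithm). *Client at $p_i$* (runs at most one procedure at a time). The call $\mathrm{qrmAccess}(m)$ sends $m$ to all servers and returns the acknowledgments of this very call once a quorum has acknowledged. `writer(v)`: query the servers and let $(z,j)$ be the largest tag in the replies; with $t=(z+1,i)$ then call $\mathrm{qrmAccess}$ with $(t,\Phi_j(v),\mathrm{pre})$ for server $j$, next with $(t,\bot,\mathrm{fin})$, and next with $(t,\bot,\mathrm{FIN})$, and return. `reader()`: query the servers and let $t$ be the largest tag in the replies;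 call $\mathrm{qrmAccess}((t,\bot,\mathrm{fin}))$; if fewer than $k+2e$ of the returned replies carry a coded element for $t$, return $\bot$; otherwise decode these coded elements, correcting at most $e$ of them, and return the result. *Server at $p_i$.* It stores a finite set $S$ of records (tag, coded element or $\bot$, phase), phases being pre, fin, FIN. The coded element for $t_0$ is $\Phi_i(v_0)$; records for $t_0$ are not stored. $\mathrm{updatePhase}(t,w,u)$ adds $(t,w,u)$ if $S$ has no record with tag $t$; otherwise it upgrades the phase of that record (pre to fin if $u=\mathrm{fin}$, fin to FIN if $u=\mathrm{FIN}$, unchanged otherwise) and replaces its coded element by $w$ if $w\ne\bot$. A query of a reader is answered with the largest tag of a record in phase fin or FIN, a query of a writer with the largest tag of any record ($t_0$ if there is none). A request $(t,w,u)$ with $u\in\{\mathrm{pre},\mathrm{fin},\mathrm{FIN}\}$ causes $\mathrm{updatePhase}(t,w,u)$ and is acknowledged with $t$, and, if it comes from a reader, with the coded element that $S$ holds for $t$ (if any). A malicious server may put an arbitrary coded element into the data field of a reply; it does not withhold a coded element and deviates in no other way. Servers keep gossiping their largest tag over all phases, over $\{\mathrm{fin},\mathrm{FIN}\}$, and over $\{\mathrm{FIN}\}$.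 On arrival of gossip a server stores it as the sender's entry, then sets $\mathrm{pre}$, $\mathrm{fin}$, $\mathrm{FIN}$ of its own entry, in this order, to the largest of: all pre, fin and FIN entries and its largest tag in $S$; all fin and FIN entries and its largest tag in phase fin or FIN; all FIN entries, its largest tag in phase FIN, and any tag that is the fin entry of a quorum; after computing each it performs $\mathrm{updatePhase}$ with that tag, $\bot$ and that phase. *Communication* between a client and a server uses one token that is reliably passed back and forth; the client loads its current request (or nothing) onto it, the server the reply to the last request it received, and requests and replies are labelled with the call of $\mathrm{qrmAccess}$ that they belong to. Between two servers one gossip message at a time is in transit. Clients and servers may fail by stopping at any time. An infinite execution $R$ is *fair* if every step of the algorithm that is applicable infinitely often is taken infinitely often. The suffix $R'$ of $R$ that starts in its $n_0$-th state is *legal* if either (i) $n_0=0$ and in the first state no procedure runs, no requests or replies are in transit, all storages are empty and all gossip messages and buffers contain only $t_0$; or (ii) $R$ starts in an arbitrary state without requests or replies in transit, and a write operation $\pi$ that is completely contained in $R$ ends in the $n_0$-th state of $R$ and is valid: there is a state $c$ of $R$, not later than the start of $\pi$, such that the tag of $\pi$ is larger than all tags that occur both in $c$ and in the first state of $R$.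 Let $R$ be fair, let $R'$ be legal, and let at most $f$ servers fail. Then: 1. every operation that is ongoing in some state of $R'$ and whose client never fails terminates; 2. for every read operation that starts in $R'$ and ends, let $t$ be the tag that it uses in its finalize phase. There is $v\in A^k$ such that $v=v_0$ if $t=t_0$, and otherwise some writer has pre-written the coded elements $\Phi_j(v)$ with the tag $t$; the replies that the reader has received in its finalize phase include coded elements from at least $k+2e$ different servers $j$, of which all but at most $e$ equal $\Phi_j(v)$ (in particular they include at least $k$ distinct correct coded elements of $v$); and the reader decodes them successfully and returns $v$. -/

import Mathlib

/-!
# Coded atomic storage with self-stabilizing servers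

`N` nodes `p_0, …, p_{N-1}`; every node hosts a server and may host a client.  The file contains the
coded atomic storage algorithm (client, server and gossip code), running over a service that
circulates one token between every client and every server and one gossip token between every two
servers, the resulting transition system, and the notions of fair and of legal execution.
-/

namespace CAS

/-! ### Tags, phases, codes, quorums -/

/-- Tags `(z, i)` of write operations, ordered lexicographically. -/
abbrev Tag (N : ℕ) : Type := ℕ+ ×ₗ Fin N

/-- Tags together with the default tag `t₀ = ⊥`, which lies below all the others. -/
abbrev Tag₀ (N : ℕ) : Type := WithBot (Tag N)

/-- The tag `(z + 1, i)`, where `z` is the number in the given tag (`0` for `t₀`). -/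
def nextTag {N : ℕ} : Tag₀ N → Fin N → Tag N
  | none, i => toLex (1, i)
  | some t, i => toLex ((ofLex t).1 + 1, i)

/-- The phases of a record: `pre`, `fin` and the one written in capital letters, `FIN`. -/
inductive Phase : Type
  | pre | fin | FIN
  deriving DecidableEq

/-- The function `upgradePhase(old, new)`. -/
def upgradePhase : Phase → Phase → Phase
  | .pre, .fin => .fin
  | .fin, .FIN => .FIN
  | old, _ => old

/-- An `(N, k)` code `Φ` is maximum distance separable: any `k` coordinates determine the input. -/
def IsMDS {N k : ℕ} {A : Type*} (Φ : (Fin k → A) → Fin N → A) : Prop :=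
  ∀ S : Finset (Fin N), S.card = k →
    ∃ inv : (S → A) → (Fin k → A), ∀ x : Fin k → A, inv (fun s => Φ x s) = x

/-- Quorums: the sets of at least `⌈(N + k + 2e) / 2⌉` servers. -/
def IsQuorum {N : ℕ} (k e : ℕ) (Q : Finset (Fin N)) : Prop :=
  N + k + 2 * e ≤ 2 * Q.card

/-- What an instance of the algorithm is given: the code, the default value `v₀` of the object, and
the set of malicious servers. -/
structure Params (N k e : ℕ) (A : Type) where
  code : (Fin k → A) → Fin N → A
  v₀ : Fin k → A
  malicious : Finset (Fin N)

/-! ### Messages -/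

inductive Role : Type
  | reader | writer

/-- The requests of a client; `(⊥, ⊥, qry)`, `(t, w, pre)` and `(t, ⊥, d)` with `d` in
`{fin, FIN}`. -/
inductive Request (N : ℕ) (A : Type) : Type
  | query (r : Role)
  | prewrite (t : Tag N) (w : Option A)
  | finalize (r : Role) (t : Tag₀ N)
  | finalizeAgain (t : Tag N)

/-- The tag and the data field of a server's reply (its phase is that of the request). -/
structure Reply (N : ℕ) (A : Type) where
  tag : Tag₀ N
  word : Option A

/-- A gossip message: the maximal tags for the three kinds of phases. -/
structure Gossip (N : ℕ) where
  pre : Tag₀ N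
  fin : Tag₀ N
  FIN : Tag₀ N

/-- The gossip message `(t₀, t₀, t₀)`. -/
def Gossip.default {N : ℕ} : Gossip N := ⟨⊥, ⊥, ⊥⟩

/-- Position of the token that circulates between a client and a server.  A request, and the reply
to it, carries the number of the client's call of `qrmAccess` to which it belongs; `none` is the
empty message. -/
inductive Wire (N : ℕ) (A : Type) : Type
  | atClient
  | toServer (m : Option (ℕ × Request N A))
  | atServer
  | toClient (m : Option (ℕ × Reply N A))

/-! ### The server -/

/-- A record `(t, w, d)` of a server's storage. -/
structure Record (N : ℕ) (A : Type) where
  tag : Tag N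
  word : Option A
  phase : Phase

/-- The largest tag of a stored record with phase in `D`; `t₀` if there is none. -/
noncomputable def maxPhase {N : ℕ} {A : Type} (S : Finset (Record N A)) (D : Finset Phase) :
    Tag₀ N :=
  (S.filter fun r => r.phase ∈ D).sup fun r => (r.tag : Tag₀ N)

def allPhases : Finset Phase := {.pre, .fin, .FIN}

def finPhases : Finset Phase := {.fin, .FIN}

def lastPhase : Finset Phase := {.FIN}

open Classical in
/-- The function `updatePhase(t, w, u)`.  A record with tag `t` has its phase upgraded, and its coded
element is replaced only if `w ≠ ⊥`; if there is no such record, then `(t, w, u)` is added.  There are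
no stored records for `t₀`. -/
noncomputable def updatePhase {N : ℕ} {A : Type} (S : Finset (Record N A)) (t : Tag₀ N)
    (w : Option A) (u : Phase) : Finset (Record N A) :=
  match t with
  | none => S
  | some t =>
    if ∃ r ∈ S, r.tag = t then
      S.image fun r =>
        if r.tag = t then ⟨t, w.orElse fun _ => r.word, upgradePhase r.phase u⟩ else r
    else insert ⟨t, w, u⟩ S

open Classical in
/-- The coded element that the server with the storage `S` has for the tag `t`, if any; `w₀` is the
server's coded element of the default value `v₀`, which belongs to the tag `t₀`. -/
noncomputable def storedWord {N : ℕ} {A : Type} (S : Finset (Record N A)) (w₀ : A) :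
    Tag₀ N → Option A
  | none => some w₀
  | some t =>
    if h : ∃ w : A, ∃ r ∈ S, r.tag = t ∧ r.word = some w then some h.choose else none

/-- The state of a server: storage, outgoing gossip, most recently received gossip of every server
(with the server's own entry used for aggregation), and, for each client, the buffer with the reply
to the most recently received request. -/
structure Server (N : ℕ) (A : Type) where
  store : Finset (Record N A)
  gossipTx : Gossip N
  gossipRx : Fin N → Gossip N
  pongTx : Fin N → Option (ℕ × Reply N A)

/-- New storage and reply when a request arrives at a server. -/
noncomputable def handle {N : ℕ} {A : Type} (S : Finset (Record N A)) (w₀ : A) :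
    Request N A → Finset (Record N A) × Reply N A
  | .query .reader => (S, ⟨maxPhase S finPhases, none⟩)
  | .query .writer => (S, ⟨maxPhase S allPhases, none⟩)
  | .prewrite t w => (updatePhase S t w .pre, ⟨t, none⟩)
  | .finalize .reader t =>
      let S' := updatePhase S t none .fin
      (S', ⟨t, storedWord S' w₀ t⟩)
  | .finalize .writer t => (updatePhase S t none .fin, ⟨t, none⟩)
  | .finalizeAgain t => (updatePhase S t none .FIN, ⟨t, none⟩)

/-- The reply `r'` that server `j` gives where the algorithm asks for `r`: a malicious server may put
an arbitrary coded element into the data field, and deviates in no other way. -/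
def MayReply {N k e : ℕ} {A : Type} (P : Params N k e A) (j : Fin N) (r r' : Reply N A) : Prop :=
  r'.tag = r.tag ∧ (j ∉ P.malicious → r'.word = r.word) ∧ (r.word ≠ none → r'.word ≠ none)

open Classical in
/-- The largest tag `t` that is the `fin` entry of a quorum of the received gossip messages; `t₀` if
there is none. -/
noncomputable def quorumFin {N : ℕ} (k e : ℕ) (g : Fin N → Gossip N) : Tag₀ N :=
  (Finset.univ.filter fun l => IsQuorum k e (Finset.univ.filter fun m => (g m).fin = (g l).fin)).sup
    fun l => (g l).fin

/-- The gossip arrival event at server `i`, with the message `m` from server `j`. -/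
noncomputable def onGossip {N : ℕ} {A : Type} (k e : ℕ) (i j : Fin N) (m : Gossip N)
    (s : Server N A) : Server N A :=
  let g := Function.update s.gossipRx j m
  let pre' := (Finset.univ.sup fun l => (g l).pre ⊔ (g l).fin ⊔ (g l).FIN) ⊔ maxPhase s.store allPhases
  let g₁ := Function.update g i { g i with pre := pre' }
  let S₁ := updatePhase s.store pre' none .pre
  let fin' := (Finset.univ.sup fun l => (g₁ l).fin ⊔ (g₁ l).FIN) ⊔ maxPhase S₁ finPhases
  let g₂ := Function.update g₁ i { g₁ i with fin := fin' }
  let S₂ := updatePhase S₁ fin' none .fin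
  let FIN' := (Finset.univ.sup fun l => (g₂ l).FIN) ⊔ maxPhase S₂ lastPhase ⊔ quorumFin k e g₂
  let g₃ := Function.update g₂ i { g₂ i with FIN := FIN' }
  let S₃ := updatePhase S₂ FIN' none .FIN
  { s with
    store := S₃
    gossipRx := g₃
    gossipTx := ⟨maxPhase S₃ allPhases, maxPhase S₃ finPhases, maxPhase S₃ lastPhase⟩ }

/-! ### The client -/

/-- The calls of a client: `reader()` and `writer(v)`. -/
inductive Op (k : ℕ) (A : Type) : Type
  | read
  | write (v : Fin k → A)

def Op.role {k : ℕ} {A : Type} : Op k A → Role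
  | .read => .reader
  | .write _ => .writer

/-- Acknowledgments that a client has collected during its current call of `qrmAccess`. -/
abbrev Acks (N : ℕ) (A : Type) : Type := Fin N → Option (Reply N A)

/-- The state of a client: either no procedure is running (`idle out`, where `out` is the result of
the last call if that was a `reader()`, and `none` stands for `⊥`), or the client waits in one of the
calls of `qrmAccess`: in the query, pre-write, finalize and last phase of a writer, or in the query
and finalize phase of a reader. -/
inductive Client (N k : ℕ) (A : Type) : Type
  | idle (out : Option (Fin k → A))
  | query (op : Op k A) (acks : Acks N A)
  | prewrite (t : Tag N) (words : Fin N → Option A) (acks : Acks N A)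
  | finalizeW (t : Tag N) (acks : Acks N A)
  | finalizeAgainW (t : Tag N) (acks : Acks N A)
  | finalizeR (t : Tag₀ N) (acks : Acks N A)

namespace Client

variable {N k : ℕ} {A : Type}

def Idle : Client N k A → Prop
  | .idle _ => True
  | _ => False

/-- The request to server `j`, if the client is waiting for acknowledgments. -/
def request : Client N k A → Fin N → Option (Request N A)
  | .idle _, _ => none
  | .query op _, _ => some (.query op.role)
  | .prewrite t words _, j => some (.prewrite t (words j))
  | .finalizeW t _, _ => some (.finalize .writer t)
  | .finalizeAgainW t _, _ => some (.finalizeAgain t)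
  | .finalizeR t _, _ => some (.finalize .reader t)

def acks : Client N k A → Acks N A
  | .idle _ => fun _ => none
  | .query _ a | .prewrite _ _ a | .finalizeW _ a | .finalizeAgainW _ a | .finalizeR _ a => a

/-- Store the acknowledgment `r` from server `j`. -/
def addAck : Client N k A → Fin N → Reply N A → Client N k A
  | .idle out, _, _ => .idle out
  | .query op a, j, r => .query op (Function.update a j (some r))
  | .prewrite t ws a, j, r => .prewrite t ws (Function.update a j (some r))
  | .finalizeW t a, j, r => .finalizeW t (Function.update a j (some r))
  | .finalizeAgainW t a, j, r => .finalizeAgainW t (Function.update a j (some r))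
  | .finalizeR t a, j, r => .finalizeR t (Function.update a j (some r))

end Client

/-- The set of servers that have acknowledged. -/
def ackSet {N : ℕ} {A : Type} (a : Acks N A) : Finset (Fin N) :=
  Finset.univ.filter fun j => (a j).isSome

/-- The maximal tag in the replies to a query. -/
def maxTag {N : ℕ} {A : Type} (a : Acks N A) : Tag₀ N :=
  Finset.univ.sup fun j => ((a j).map Reply.tag).getD ⊥

open Classical in
/-- The coded element for the tag `t` in the acknowledgment of server `j`, if it has one. -/
noncomputable def ackWord {N : ℕ} {A : Type} (t : Tag₀ N) (a : Acks N A) (j : Fin N) : Option A :=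
  (a j).bind fun r => if r.tag = t then r.word else none

/-- The servers from which a coded element has been received. -/
def received {N : ℕ} {A : Type} (ws : Fin N → Option A) : Finset (Fin N) :=
  Finset.univ.filter fun j => (ws j).isSome

open Classical in
/-- The servers from which the coded element of `v` has been received. -/
noncomputable def matching {N k : ℕ} {A : Type} (Φ : (Fin k → A) → Fin N → A)
    (ws : Fin N → Option A) (v : Fin k → A) : Finset (Fin N) :=
  Finset.univ.filter fun j => ws j = some (Φ v j)

open Classical in
/-- The value that a reader returns: `⊥` if there are fewer than `k + 2e` coded elements, and otherwise
the result of decoding while correcting at most `e` of them. -/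
noncomputable def decode {N k : ℕ} {A : Type} (e : ℕ) (Φ : (Fin k → A) → Fin N → A)
    (ws : Fin N → Option A) : Option (Fin k → A) :=
  if h : k + 2 * e ≤ (received ws).card ∧
      ∃ v : Fin k → A, (received ws).card ≤ (matching Φ ws v).card + e then
    some h.2.choose
  else none

/-- What the client at node `i` does when its current call of `qrmAccess` returns. -/
noncomputable def Client.advance {N k e : ℕ} {A : Type} (P : Params N k e A) (i : Fin N) :
    Client N k A → Client N k A
  | .idle out => .idle out
  | .query .read a => .finalizeR (maxTag a) fun _ => none
  | .query (.write v) a =>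
      .prewrite (nextTag (maxTag a) i) (fun j => some (P.code v j)) fun _ => none
  | .prewrite t _ _ => .finalizeW t fun _ => none
  | .finalizeW t _ => .finalizeAgainW t fun _ => none
  | .finalizeAgainW _ _ => .idle none
  | .finalizeR t a => .idle (decode e P.code (ackWord t a))

/-! ### System states and steps -/

/-- A system state: clients, the number of the current call of `qrmAccess` of each client, servers, the
token between each client and each server, the gossip message in transit from one server to another
(if any), and the sets of clients and of servers that have failed. -/
structure State (N k : ℕ) (A : Type) where
  client : Fin N → Client N k A
  calls : Fin N → ℕ
  server : Fin N → Server N A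
  wire : Fin N → Fin N → Wire N A
  gossipWire : Fin N → Fin N → Option (Gossip N)
  deadClients : Finset (Fin N)
  deadServers : Finset (Fin N)

/-- Names of steps.  In the ping and pong steps the first index is the client and the second the
server; in the gossip steps the first is the sender and the second the receiver. -/
inductive Label (N k : ℕ) (A : Type) : Type
  | pingDepart (i j : Fin N)
  | pingArrive (i j : Fin N)
  | pongDepart (i j : Fin N)
  | pongArrive (i j : Fin N)
  | advance (i : Fin N)
  | gossipDepart (i j : Fin N)
  | gossipArrive (i j : Fin N)
  | invoke (i : Fin N) (op : Op k A)
  | crashClient (i : Fin N)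
  | crashServer (j : Fin N)
  | skip

/-- The steps of the algorithm, as opposed to those of the environment. -/
def Label.IsAlgorithmStep {N k : ℕ} {A : Type} : Label N k A → Prop
  | .invoke _ _ | .crashClient _ | .crashServer _ | .skip => False
  | _ => True

namespace State

variable {N k : ℕ} {A : Type}

def setClient (s : State N k A) (i : Fin N) (c : Client N k A) : State N k A :=
  { s with client := Function.update s.client i c }

def setServer (s : State N k A) (j : Fin N) (x : Server N A) : State N k A :=
  { s with server := Function.update s.server j x }

def setWire (s : State N k A) (i j : Fin N) (w : Wire N A) : State N k A :=
  { s with wire := Function.update s.wire i (Function.update (s.wire i) j w) }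

def setGossipWire (s : State N k A) (i j : Fin N) (m : Option (Gossip N)) : State N k A :=
  { s with gossipWire := Function.update s.gossipWire i (Function.update (s.gossipWire i) j m) }

def setPong (s : State N k A) (j i : Fin N) (m : Option (ℕ × Reply N A)) : State N k A :=
  s.setServer j { s.server j with pongTx := Function.update (s.server j).pongTx i m }

def setStore (s : State N k A) (j : Fin N) (S : Finset (Record N A)) : State N k A :=
  s.setServer j { s.server j with store := S }

def newCall (s : State N k A) (i : Fin N) : State N k A :=
  { s with calls := Function.update s.calls i (s.calls i + 1) }

end State

/-- The steps of the system. -/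
inductive Step {N k e : ℕ} {A : Type} (P : Params N k e A) :
    State N k A → Label N k A → State N k A → Prop
  /-- The client at `i`, which runs no procedure, is called and starts its query. -/
  | invoke (s : State N k A) (i : Fin N) (op : Op k A)
      (alive : i ∉ s.deadClients) (h : (s.client i).Idle) :
      Step P s (.invoke i op) ((s.setClient i (.query op fun _ => none)).newCall i)
  /-- The token leaves the client with its current request (or empty). -/
  | pingDepart (s : State N k A) (i j : Fin N)
      (alive : i ∉ s.deadClients) (h : s.wire i j = .atClient) :
      Step P s (.pingDepart i j)
        (s.setWire i j (.toServer (((s.client i).request j).map fun q => (s.calls i, q))))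
  /-- The token reaches the server without a request. -/
  | pingArriveEmpty (s : State N k A) (i j : Fin N)
      (alive : j ∉ s.deadServers) (h : s.wire i j = .toServer none) :
      Step P s (.pingArrive i j) ((s.setPong j i none).setWire i j .atServer)
  /-- The token reaches the server with a request, which the server handles. -/
  | pingArrive (s : State N k A) (i j : Fin N) (n : ℕ) (q : Request N A) (r : Reply N A)
      (alive : j ∉ s.deadServers) (h : s.wire i j = .toServer (some (n, q)))
      (hr : MayReply P j (handle (s.server j).store (P.code P.v₀ j) q).2 r) :
      Step P s (.pingArrive i j)
        (((s.setStore j (handle (s.server j).store (P.code P.v₀ j) q).1).setPong j i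
          (some (n, r))).setWire i j .atServer)
  /-- The token leaves the server with the content of the reply buffer. -/
  | pongDepart (s : State N k A) (i j : Fin N)
      (alive : j ∉ s.deadServers) (h : s.wire i j = .atServer) :
      Step P s (.pongDepart i j) (s.setWire i j (.toClient ((s.server j).pongTx i)))
  /-- The token reaches the client with an acknowledgment of the current request. -/
  | pongArrive (s : State N k A) (i j : Fin N) (r : Reply N A)
      (alive : i ∉ s.deadClients) (h : s.wire i j = .toClient (some (s.calls i, r))) :
      Step P s (.pongArrive i j)
        ((s.setClient i ((s.client i).addAck j r)).setWire i j .atClient)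
  /-- The token reaches the client with anything else, which is ignored. -/
  | pongArriveOther (s : State N k A) (i j : Fin N) (m : Option (ℕ × Reply N A))
      (alive : i ∉ s.deadClients) (h : s.wire i j = .toClient m)
      (hm : ∀ r : Reply N A, m ≠ some (s.calls i, r)) :
      Step P s (.pongArrive i j) (s.setWire i j .atClient)
  /-- A quorum has acknowledged the request of the client at `i`: the call of `qrmAccess` returns, and
  the client starts its next phase or returns from its procedure. -/
  | advance (s : State N k A) (i : Fin N)
      (alive : i ∉ s.deadClients) (busy : ¬ (s.client i).Idle)
      (h : IsQuorum k e (ackSet (s.client i).acks)) :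
      Step P s (.advance i) ((s.setClient i ((s.client i).advance P i)).newCall i)
  /-- Server `i` sends its current gossip message to server `j`. -/
  | gossipDepart (s : State N k A) (i j : Fin N) (ne : i ≠ j)
      (alive : i ∉ s.deadServers) (h : s.gossipWire i j = none) :
      Step P s (.gossipDepart i j) (s.setGossipWire i j (some (s.server i).gossipTx))
  /-- A gossip message from server `i` reaches server `j`. -/
  | gossipArrive (s : State N k A) (i j : Fin N) (m : Gossip N) (ne : i ≠ j)
      (alive : j ∉ s.deadServers) (h : s.gossipWire i j = some m) :
      Step P s (.gossipArrive i j)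
        ((s.setServer j (onGossip k e j i m (s.server j))).setGossipWire i j none)
  | crashClient (s : State N k A) (i : Fin N) :
      Step P s (.crashClient i) { s with deadClients := insert i s.deadClients }
  | crashServer (s : State N k A) (j : Fin N) :
      Step P s (.crashServer j) { s with deadServers := insert j s.deadServers }
  | skip (s : State N k A) : Step P s .skip s

/-! ### Executions -/

/-- An (unbounded) execution, from an arbitrary system state. -/
structure Execution {N k e : ℕ} {A : Type} (P : Params N k e A) where
  state : ℕ → State N k A
  label : ℕ → Label N k A
  step : ∀ n, Step P (state n) (label n) (state (n + 1))

/-- Fairness: every step of the algorithm that is applicable infinitely often is taken infinitely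
often. -/
def Execution.Fair {N k e : ℕ} {A : Type} {P : Params N k e A} (R : Execution P) : Prop :=
  ∀ l : Label N k A, l.IsAlgorithmStep →
    (∃ᶠ n in Filter.atTop, ∃ s' : State N k A, Step P (R.state n) l s') →
      ∃ᶠ n in Filter.atTop, R.label n = l

namespace State

variable {N k : ℕ} {A : Type}

/-- No request and no reply is in transit or waits in a server's reply buffer, so that all those
delivered later on have been sent later on. -/
def NoStaleMessages (s : State N k A) : Prop :=
  (∀ i j, s.wire i j = .atClient ∨ s.wire i j = .toServer none ∨ s.wire i j = .atServer ∨
    s.wire i j = .toClient none) ∧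
  ∀ i j, (s.server j).pongTx i = none

/-- The well-initialized states: no procedure is running, no requests and replies are in transit, all
gossip messages are `(t₀, t₀, t₀)`, and all storages are empty. -/
def Safe (s : State N k A) : Prop :=
  s.NoStaleMessages ∧
  (∀ i, (s.client i).Idle) ∧
  (∀ i j, s.gossipWire i j = none ∨ s.gossipWire i j = some .default) ∧
  ∀ j, (s.server j).store = ∅ ∧ (s.server j).gossipTx = .default ∧
    ∀ l, (s.server j).gossipRx l = .default

end State

/-! ### The tags in a system state -/

section Tags

variable {N k : ℕ} {A : Type}

def Gossip.HasTag (g : Gossip N) (t : Tag N) : Prop :=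
  g.pre = t ∨ g.fin = t ∨ g.FIN = t

def Request.HasTag : Request N A → Tag N → Prop
  | .query _, _ => False
  | .prewrite t' _, t => t' = t
  | .finalize _ t', t => t' = t
  | .finalizeAgain t', t => t' = t

def Wire.HasTag : Wire N A → Tag N → Prop
  | .atClient, _ | .atServer, _ => False
  | .toServer m, t => ∃ n q, m = some (n, q) ∧ Request.HasTag q t
  | .toClient m, t => ∃ n r, m = some (n, r) ∧ r.tag = t

def Server.HasTag (s : Server N A) (t : Tag N) : Prop :=
  (∃ r ∈ s.store, r.tag = t) ∨ s.gossipTx.HasTag t ∨ (∃ l, (s.gossipRx l).HasTag t) ∨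
    ∃ i n r, s.pongTx i = some (n, r) ∧ r.tag = t

def Client.HasTag (c : Client N k A) (t : Tag N) : Prop :=
  (∃ j q, c.request j = some q ∧ q.HasTag t) ∨ ∃ j r, c.acks j = some r ∧ r.tag = t

/-- The tag `t` occurs in the state of a node or in a message in transit. -/
def State.HasTag (s : State N k A) (t : Tag N) : Prop :=
  (∃ i, (s.client i).HasTag t) ∨ (∃ j, (s.server j).HasTag t) ∨ (∃ i j, (s.wire i j).HasTag t) ∨
    ∃ i j g, s.gossipWire i j = some g ∧ g.HasTag t

end Tags

/-! ### Operations and legal executions -/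

namespace Execution

variable {N k e : ℕ} {A : Type} {P : Params N k e A}

/-- Step `a` invokes `op` at the client of node `i`, and step `b` is the one that ends this operation:
the client is busy in all states between them and is not after step `b`. -/
def CompleteOp (R : Execution P) (i : Fin N) (op : Op k A) (a b : ℕ) : Prop :=
  a < b ∧ R.label a = .invoke i op ∧ (∀ n, a < n → n ≤ b → ¬ ((R.state n).client i).Idle) ∧
    ((R.state (b + 1)).client i).Idle

/-- The complete write operation that starts at step `a` and ends at step `b` has the tag `t`, and is
valid: there is a system state, no later than the start of the operation, such that `t` is greater than
all the tags that occur both in it and in the starting state of the execution. -/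
def ValidWrite (R : Execution P) (i : Fin N) (a b : ℕ) (t : Tag N) : Prop :=
  (∃ v, R.CompleteOp i (.write v) a b) ∧
  (∃ acks, (R.state b).client i = .finalizeAgainW t acks) ∧
  ∃ m, m ≤ a ∧ ∀ t' : Tag N, (R.state 0).HasTag t' → (R.state m).HasTag t' → t' < t

/-- The suffix of the execution from its `n`-th state on is a legal execution: either the execution
starts in a well-initialized state and `n = 0`, or it starts in an arbitrary state without stale
requests and replies in transit, and a complete and valid write operation ends in its `n`-th state. -/
def LegalFrom (R : Execution P) (n : ℕ) : Prop :=
  (n = 0 ∧ (R.state 0).Safe) ∨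
  ((R.state 0).NoStaleMessages ∧ ∃ i a b t, R.ValidWrite i a b t ∧ n = b + 1)

/-- The value `v` has been written with the tag `t`, by step `b`: it is the default value and `t = t₀`,
or a writer has pre-written with the tag `t` the coded elements of `v`. -/
def IsVersion (R : Execution P) (b : ℕ) (t : Tag₀ N) (v : Fin k → A) : Prop :=
  (t = ⊥ ∧ v = P.v₀) ∨
  ∃ m, m ≤ b ∧ ∃ (i : Fin N) (τ : Tag N) (acks : Acks N A), t = τ ∧
    (R.state m).client i = .prewrite τ (fun j => some (P.code v j)) acks

end Execution

end CAS

/-!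
**Termination.** By fairness every token between two nodes that never fail keeps moving, so every
server that never fails eventually acknowledges the current call of `qrmAccess`. At least `N - f`
servers never fail, and they form a quorum because `k + 2 * (f + e) ≤ N`. A procedure makes at most
four calls.

**Reads.** Two quorums share at least `k + 2 * e` servers. A legal suffix provides a bound that the
tag `t` of a read in it cannot be below, either because `t₀` is that bound or because a valid write
has finalized its tag at a quorum; hence, unless `t = t₀`, some earlier state contains no trace of
`t`. From that state on, the life of `t` has three stages: nobody uses it; the one writer that it
names pre-writes it; a quorum holds its coded elements. It can be finalized only in the last stage,
and no writer ever chooses it a second time, since the query quorum of that writer would meet one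
that knows `t`. So the quorum of the reader shares `k + 2 * e` servers with one that holds the coded
elements of a single value, and at most `e` of the elements it returns are wrong. Two values that
each agree with all but `e` of these elements share `k` coordinates, so the MDS property makes
decoding unambiguous.
-/

namespace CAS

/-! ### Tags, quorums and decoding -/

section Decoding

variable {N k e : ℕ} {A : Type}

theorem finset_sup_ne {α ι : Type*} [LinearOrder α] [OrderBot α] {s : Finset ι} {g : ι → α} {a : α}
    (ha : a ≠ ⊥) (h : ∀ i ∈ s, g i ≠ a) : s.sup g ≠ a :=
  Finset.sup_induction (p := fun x => x ≠ a) ha.symm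
    (fun _ hx _ hy => sup_ind (p := (· ≠ a)) _ _ hx hy) h

theorem nextTag_snd (t : Tag₀ N) (i : Fin N) : (ofLex (nextTag t i)).2 = i := by
  cases t <;> rfl

theorem lt_nextTag (t : Tag₀ N) (i : Fin N) : t < (nextTag t i : Tag₀ N) := by
  cases t using WithBot.recBotCoe with
  | bot => exact WithBot.bot_lt_coe _
  | coe t => exact WithBot.coe_lt_coe.2 (Prod.Lex.lt_iff.2 (Or.inl (PNat.lt_add_right _ _)))

theorem mem_ackSet {a : Acks N A} {j : Fin N} : j ∈ ackSet a ↔ ∃ r, a j = some r := by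
  simp [ackSet, Option.isSome_iff_exists]

theorem le_maxTag {a : Acks N A} {j : Fin N} {r : Reply N A} (h : a j = some r) :
    r.tag ≤ maxTag a := by
  have hle : ((a j).map Reply.tag).getD ⊥ ≤ maxTag a :=
    Finset.le_sup (f := fun j => ((a j).map Reply.tag).getD ⊥) (Finset.mem_univ j)
  rwa [h] at hle

theorem maxTag_ne {a : Acks N A} {τ : Tag N} (h : ∀ j r, a j = some r → r.tag ≠ τ) :
    maxTag a ≠ τ := by
  refine finset_sup_ne WithBot.coe_ne_bot fun j _ => ?_
  rcases ha : a j with _ | r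
  · simp
  · simpa using h j r ha

theorem IsQuorum.mono {Q Q' : Finset (Fin N)} (h : IsQuorum k e Q) (hQ : Q ⊆ Q') :
    IsQuorum k e Q' :=
  h.trans (Nat.mul_le_mul_left 2 (Finset.card_le_card hQ))

theorem IsQuorum.le_card_inter {Q Q' : Finset (Fin N)} (h : IsQuorum k e Q)
    (h' : IsQuorum k e Q') : k + 2 * e ≤ (Q ∩ Q').card := by
  have hsum := Finset.card_union_add_card_inter Q Q'
  have hunion : (Q ∪ Q').card ≤ N := by simpa using Finset.card_le_univ (Q ∪ Q')
  unfold IsQuorum at h h'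
  omega

theorem IsQuorum.inter_nonempty (hk : 1 ≤ k) {Q Q' : Finset (Fin N)} (h : IsQuorum k e Q)
    (h' : IsQuorum k e Q') : (Q ∩ Q').Nonempty :=
  Finset.card_pos.1 (by have := h.le_card_inter h'; omega)

variable {Φ : (Fin k → A) → Fin N → A} {ws : Fin N → Option A} {v v' : Fin k → A}

theorem mem_received {j : Fin N} : j ∈ received ws ↔ ws j ≠ none := by
  simp [received, Option.isSome_iff_ne_none]

theorem mem_matching {j : Fin N} : j ∈ matching Φ ws v ↔ ws j = some (Φ v j) := by
  simp [matching]

theorem matching_subset_received : matching Φ ws v ⊆ received ws := fun j hj => by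
  simp [mem_received, mem_matching.1 hj]

theorem card_received_le {M : Finset (Fin N)} (hM : M.card ≤ e)
    (h : ∀ j ∉ M, ∀ w ∈ ws j, w = Φ v j) :
    (received ws).card ≤ (matching Φ ws v).card + e := by
  have hsub : received ws ⊆ matching Φ ws v ∪ M := fun j hj => by
    obtain ⟨w, hw⟩ := Option.ne_none_iff_exists'.1 (mem_received.1 hj)
    rw [Finset.mem_union, mem_matching, or_iff_not_imp_right]
    exact fun hjM => h j hjM w hw ▸ hw
  have := Finset.card_le_card hsub
  have := Finset.card_union_le (matching Φ ws v) M
  omega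

theorem IsMDS.eq_of_forall_mem_eq (hΦ : IsMDS Φ) {S : Finset (Fin N)} (hS : k ≤ S.card)
    (h : ∀ j ∈ S, Φ v j = Φ v' j) : v = v' := by
  obtain ⟨T, hTS, hT⟩ := Finset.exists_subset_card_eq hS
  obtain ⟨inv, hinv⟩ := hΦ T hT
  rw [← hinv v, ← hinv v']
  exact congrArg inv (funext fun j => h j (hTS j.2))

theorem IsMDS.eq_of_card_received_le (hΦ : IsMDS Φ) (hr : k + 2 * e ≤ (received ws).card)
    (h : (received ws).card ≤ (matching Φ ws v).card + e)
    (h' : (received ws).card ≤ (matching Φ ws v').card + e) : v = v' := by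
  have hsum := Finset.card_union_add_card_inter (matching Φ ws v) (matching Φ ws v')
  have hunion := Finset.card_le_card (Finset.union_subset
    (matching_subset_received (Φ := Φ) (ws := ws) (v := v))
    (matching_subset_received (Φ := Φ) (ws := ws) (v := v')))
  refine hΦ.eq_of_forall_mem_eq (S := matching Φ ws v ∩ matching Φ ws v') (by omega) fun j hj => ?_
  obtain ⟨hj, hj'⟩ := Finset.mem_inter.1 hj
  exact Option.some.inj ((mem_matching.1 hj).symm.trans (mem_matching.1 hj'))

theorem decode_eq_some (hΦ : IsMDS Φ) (hr : k + 2 * e ≤ (received ws).card)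
    (h : (received ws).card ≤ (matching Φ ws v).card + e) : decode e Φ ws = some v := by
  have hdec : k + 2 * e ≤ (received ws).card ∧
      ∃ v : Fin k → A, (received ws).card ≤ (matching Φ ws v).card + e := ⟨hr, v, h⟩
  rw [decode, dif_pos hdec, hΦ.eq_of_card_received_le hr hdec.2.choose_spec h]

end Decoding

/-! ### Server storages -/

section Storage

variable {N : ℕ} {A : Type} {S S' : Finset (Record N A)} {τ : Tag N}

theorem mem_updatePhase_coe {t : Tag N} {w : Option A} {u : Phase} {r : Record N A} :
    r ∈ updatePhase S t w u ↔ (r ∈ S ∧ r.tag ≠ t) ∨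
      (∃ r' ∈ S, r'.tag = t ∧ r = ⟨t, w.orElse fun _ => r'.word, upgradePhase r'.phase u⟩) ∨
      ((∀ r' ∈ S, r'.tag ≠ t) ∧ r = ⟨t, w, u⟩) := by
  classical
  change r ∈ (if ∃ r ∈ S, r.tag = t then _ else _) ↔ _
  split_ifs with h
  · rw [Finset.mem_image]
    grind
  · rw [Finset.mem_insert]
    grind

/-- The relation between the storages of a server at two successive times: no record is lost,
records keep some coded element if they have one, and finalized records remain finalized. -/
def Persists (S S' : Finset (Record N A)) : Prop :=
  ∀ r ∈ S, ∃ r' ∈ S', r'.tag = r.tag ∧ (r.word ≠ none → r'.word ≠ none) ∧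
    (r.phase ∈ finPhases → r'.phase ∈ finPhases)

/-- The storage has a coded element for the tag `τ`. -/
def HoldsWord (S : Finset (Record N A)) (τ : Tag N) : Prop :=
  ∃ r ∈ S, r.tag = τ ∧ r.word ≠ none

/-- The only coded element that the storage may have for the tag `τ` is `x`. -/
def OnlyWord (τ : Tag N) (x : A) (S : Finset (Record N A)) : Prop :=
  ∀ r ∈ S, r.tag = τ → ∀ w ∈ r.word, w = x

/-- The phases of the records in which a server looks for the answer to a query. -/
def Role.phases : Role → Finset Phase
  | .reader => finPhases
  | .writer => allPhases

theorem mem_allPhases (p : Phase) : p ∈ allPhases := by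
  cases p <;> simp [allPhases]

theorem upgradePhase_pre (p : Phase) : upgradePhase p .pre = p := by
  cases p <;> rfl

theorem upgradePhase_fin_mem_finPhases (p : Phase) : upgradePhase p .fin ∈ finPhases := by
  cases p <;> simp [finPhases, upgradePhase]

theorem upgradePhase_mem_finPhases {p : Phase} (h : p ∈ finPhases) (u : Phase) :
    upgradePhase p u ∈ finPhases := by
  cases p <;> cases u <;> simp_all [finPhases, upgradePhase]

theorem handle_query (S : Finset (Record N A)) (w₀ : A) (r : Role) :
    handle S w₀ (.query r) = (S, ⟨maxPhase S r.phases, none⟩) := by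
  cases r <;> rfl

theorem le_maxPhase {D : Finset Phase} {r : Record N A} (hr : r ∈ S) (hD : r.phase ∈ D) :
    (r.tag : Tag₀ N) ≤ maxPhase S D :=
  Finset.le_sup (f := fun r : Record N A => (r.tag : Tag₀ N)) (Finset.mem_filter.2 ⟨hr, hD⟩)

theorem le_maxPhase_updatePhase_fin (S : Finset (Record N A)) (t : Tag₀ N) (w : Option A) :
    t ≤ maxPhase (updatePhase S t w .fin) finPhases := by
  cases t using WithBot.recBotCoe with
  | bot => exact bot_le
  | coe t =>
    by_cases h : ∃ r ∈ S, r.tag = t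
    · obtain ⟨r, hr, ht⟩ := h
      exact le_maxPhase (mem_updatePhase_coe.2 (Or.inr (Or.inl ⟨r, hr, ht, rfl⟩)))
        (upgradePhase_fin_mem_finPhases _)
    · push Not at h
      exact le_maxPhase (r := ⟨t, w, .fin⟩) (mem_updatePhase_coe.2 (Or.inr (Or.inr ⟨h, rfl⟩)))
        (by simp [finPhases])

theorem holdsWord_updatePhase (S : Finset (Record N A)) (t : Tag N) (w : A) (u : Phase) :
    HoldsWord (updatePhase S t (some w) u) t := by
  by_cases h : ∃ r ∈ S, r.tag = t
  · obtain ⟨r, hr, ht⟩ := h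
    exact ⟨_, mem_updatePhase_coe.2 (Or.inr (Or.inl ⟨r, hr, ht, rfl⟩)), rfl, by simp⟩
  · push Not at h
    exact ⟨_, mem_updatePhase_coe.2 (Or.inr (Or.inr ⟨h, rfl⟩)), rfl, by simp⟩

theorem Persists.refl (S : Finset (Record N A)) : Persists S S :=
  fun r hr => ⟨r, hr, rfl, id, id⟩

theorem Persists.trans {S'' : Finset (Record N A)} (h : Persists S S') (h' : Persists S' S'') :
    Persists S S'' := by
  intro r hr
  obtain ⟨r', hr', htag, hword, hphase⟩ := h r hr
  obtain ⟨r'', hr'', htag', hword', hphase'⟩ := h' r' hr'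
  exact ⟨r'', hr'', htag'.trans htag, hword' ∘ hword, hphase' ∘ hphase⟩

theorem persists_updatePhase (S : Finset (Record N A)) (t : Tag₀ N) (w : Option A) (u : Phase) :
    Persists S (updatePhase S t w u) := by
  cases t using WithBot.recBotCoe with
  | bot => exact .refl S
  | coe t =>
    intro r hr
    by_cases ht : r.tag = t
    · refine ⟨_, mem_updatePhase_coe.2 (Or.inr (Or.inl ⟨r, hr, ht, rfl⟩)), ht.symm, fun hw => ?_,
        fun hp => upgradePhase_mem_finPhases hp u⟩
      cases w <;> simp [hw]
    · exact ⟨r, mem_updatePhase_coe.2 (Or.inl ⟨hr, ht⟩), rfl, id, id⟩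

theorem persists_handle (S : Finset (Record N A)) (w₀ : A) (q : Request N A) :
    Persists S (handle S w₀ q).1 := by
  rcases q with (_ | _) | _ | ⟨_ | _, _⟩ | _
  all_goals first | exact .refl S | exact persists_updatePhase _ _ _ _

theorem persists_onGossip (k e : ℕ) (i j : Fin N) (m : Gossip N) (s : Server N A) :
    Persists s.store (onGossip k e i j m s).store :=
  ((persists_updatePhase _ _ _ _).trans (persists_updatePhase _ _ _ _)).trans
    (persists_updatePhase _ _ _ _)

theorem Persists.maxPhase_le (h : Persists S S') (r : Role) :
    maxPhase S r.phases ≤ maxPhase S' r.phases := by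
  refine Finset.sup_le fun x hx => ?_
  obtain ⟨hx, hphase⟩ := Finset.mem_filter.1 hx
  obtain ⟨x', hx', htag, -, hfin⟩ := h x hx
  rw [← htag]
  refine le_maxPhase hx' ?_
  cases r with
  | reader => exact hfin hphase
  | writer => exact mem_allPhases _

theorem HoldsWord.of_persists (h : HoldsWord S τ) (hS : Persists S S') : HoldsWord S' τ := by
  obtain ⟨r, hr, htag, hword⟩ := h
  obtain ⟨r', hr', htag', hword', -⟩ := hS r hr
  exact ⟨r', hr', htag'.trans htag, hword' hword⟩

theorem HoldsWord.le_maxPhase (h : HoldsWord S τ) : (τ : Tag₀ N) ≤ maxPhase S allPhases := by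
  obtain ⟨r, hr, rfl, -⟩ := h
  exact CAS.le_maxPhase hr (mem_allPhases _)

open Classical in
theorem storedWord_coe (S : Finset (Record N A)) (w₀ : A) (τ : Tag N) :
    storedWord S w₀ τ =
      if h : ∃ w : A, ∃ r ∈ S, r.tag = τ ∧ r.word = some w then some h.choose else none :=
  rfl

theorem HoldsWord.storedWord_ne_none (h : HoldsWord S τ) (w₀ : A) : storedWord S w₀ τ ≠ none := by
  obtain ⟨r, hr, htag, hword⟩ := h
  obtain ⟨w, hw⟩ := Option.ne_none_iff_exists'.1 hword
  rw [storedWord_coe, dif_pos ⟨w, r, hr, htag, hw⟩]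
  exact Option.some_ne_none _

theorem OnlyWord.eq_of_mem_storedWord {x w₀ w : A} (h : OnlyWord τ x S)
    (hw : w ∈ storedWord S w₀ τ) : w = x := by
  rw [storedWord_coe] at hw
  split_ifs at hw with hex
  · obtain ⟨r, hr, htag, hword⟩ := hex.choose_spec
    rw [← Option.some.inj hw]
    exact h r hr htag _ hword
  · cases hw

theorem OnlyWord.updatePhase {x : A} (h : OnlyWord τ x S) {t : Tag₀ N} {w : Option A} {u : Phase}
    (hw : t = τ → ∀ y ∈ w, y = x) : OnlyWord τ x (updatePhase S t w u) := by
  cases t using WithBot.recBotCoe with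
  | bot => exact h
  | coe t =>
    intro r hr htag y hy
    rcases mem_updatePhase_coe.1 hr with ⟨hr, -⟩ | ⟨r', hr', htag', rfl⟩ | ⟨-, rfl⟩
    · exact h r hr htag y hy
    · obtain rfl : t = τ := htag
      cases w with
      | none => exact h r' hr' htag' y hy
      | some w => exact hw rfl y hy
    · exact hw (congrArg _ htag) y hy

theorem OnlyWord.handle {x : A} (h : OnlyWord τ x S) (w₀ : A) {q : Request N A}
    (hq : ∀ w, q = .prewrite τ w → w = some x) : OnlyWord τ x (handle S w₀ q).1 := by
  rcases q with (_ | _) | ⟨t, w⟩ | ⟨_ | _, _⟩ | _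
  · exact h
  · exact h
  · refine h.updatePhase fun ht y hy => ?_
    obtain rfl : t = τ := WithBot.coe_inj.1 ht
    simpa [hq w rfl, eq_comm] using hy
  all_goals exact h.updatePhase (by simp)

theorem OnlyWord.onGossip {x : A} {s : Server N A} (h : OnlyWord τ x s.store) (k e : ℕ)
    (i j : Fin N) (m : Gossip N) : OnlyWord τ x (onGossip k e i j m s).store :=
  ((h.updatePhase (by simp)).updatePhase (by simp)).updatePhase (by simp)

end Storage

/-! ### Tags that are not finalized -/

section Unfinalized

variable {N : ℕ} {A : Type} {S : Finset (Record N A)} {τ : Tag N}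

/-- All records of the tag `τ` in the storage are in the phase `pre`. -/
def Unfinalized (τ : Tag N) (S : Finset (Record N A)) : Prop :=
  ∀ r ∈ S, r.tag = τ → r.phase = .pre

/-- The tag `τ` is neither the `fin` nor the `FIN` entry of the gossip message. -/
structure Gossip.Unfinalized (τ : Tag N) (g : Gossip N) : Prop where
  fin_ne : g.fin ≠ τ
  FIN_ne : g.FIN ≠ τ

/-- The server has the tag `τ` neither in a finalized record nor in a `fin` or `FIN` entry. -/
structure Server.Unfinalized (τ : Tag N) (s : Server N A) : Prop where
  store : CAS.Unfinalized τ s.store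
  gossipTx : s.gossipTx.Unfinalized τ
  gossipRx : ∀ l, (s.gossipRx l).Unfinalized τ

/-- The request does not ask for a finalization of the tag `τ`. -/
def Request.Unfinalized (τ : Tag N) : Request N A → Prop
  | .query _ | .prewrite _ _ => True
  | .finalize _ t => t ≠ τ
  | .finalizeAgain t => t ≠ τ

theorem Unfinalized.updatePhase (h : Unfinalized τ S) {t : Tag₀ N} {w : Option A} {u : Phase}
    (hu : t = τ → u = .pre) : Unfinalized τ (updatePhase S t w u) := by
  cases t using WithBot.recBotCoe with
  | bot => exact h
  | coe t =>
    intro r hr htag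
    rcases mem_updatePhase_coe.1 hr with ⟨hr, -⟩ | ⟨r', hr', htag', rfl⟩ | ⟨-, rfl⟩
    · exact h r hr htag
    · obtain rfl : t = τ := htag
      rw [hu rfl, upgradePhase_pre, h r' hr' htag']
    · exact hu (congrArg _ htag)

theorem Unfinalized.maxPhase_ne (h : Unfinalized τ S) {D : Finset Phase} (hD : .pre ∉ D) :
    maxPhase S D ≠ τ := by
  refine finset_sup_ne WithBot.coe_ne_bot fun r hr htag => hD ?_
  obtain ⟨hr, hphase⟩ := Finset.mem_filter.1 hr
  rwa [h r hr (WithBot.coe_inj.1 htag)] at hphase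

theorem pre_notMem_finPhases : .pre ∉ finPhases := by simp [finPhases]

theorem pre_notMem_lastPhase : .pre ∉ lastPhase := by simp [lastPhase]

theorem Unfinalized.handle (h : Unfinalized τ S) (w₀ : A) {q : Request N A}
    (hq : q.Unfinalized τ) : Unfinalized τ (handle S w₀ q).1 := by
  rcases q with (_ | _) | ⟨t, w⟩ | ⟨_ | _, _⟩ | _
  · exact h
  · exact h
  · exact h.updatePhase fun _ => rfl
  · exact h.updatePhase fun ht => absurd ht hq
  · exact h.updatePhase fun ht => absurd ht hq
  · exact h.updatePhase fun ht => absurd (WithBot.coe_inj.1 ht) hq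

theorem forall_update_apply {α β : Type*} [DecidableEq α] {p : β → Prop} {g : α → β} {a : α}
    {b : β} (hb : p b) (hg : ∀ x, p (g x)) (x : α) : p (Function.update g a b x) := by
  rw [Function.update_apply]
  split_ifs
  exacts [hb, hg x]

theorem Server.Unfinalized.onGossip {s : Server N A} (h : s.Unfinalized τ) (k e : ℕ) (i j : Fin N)
    {m : Gossip N} (hm : m.Unfinalized τ) : (onGossip k e i j m s).Unfinalized τ := by
  have sup_ne : ∀ {x y : Tag₀ N}, x ≠ τ → y ≠ τ → x ⊔ y ≠ τ := fun hx hy =>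
    sup_ind (p := (· ≠ (τ : Tag₀ N))) _ _ hx hy
  have fsup_ne : ∀ {s : Finset (Fin N)} {g : Fin N → Tag₀ N}, (∀ l, g l ≠ τ) → s.sup g ≠ τ :=
    fun hg => finset_sup_ne WithBot.coe_ne_bot fun l _ => hg l
  unfold CAS.onGossip
  extract_lets g pre' c₁ g₁ S₁ fin' c₂ g₂ S₂ FIN' c₃ g₃ S₃
  have hg : ∀ l, (g l).Unfinalized τ := forall_update_apply hm h.gossipRx
  have hg₁ : ∀ l, (g₁ l).Unfinalized τ := forall_update_apply ⟨(hg i).fin_ne, (hg i).FIN_ne⟩ hg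
  have hS₁ : CAS.Unfinalized τ S₁ := h.store.updatePhase fun _ => rfl
  have hfin : fin' ≠ τ := sup_ne (fsup_ne fun l => sup_ne (hg₁ l).fin_ne (hg₁ l).FIN_ne)
    (hS₁.maxPhase_ne pre_notMem_finPhases)
  have hg₂ : ∀ l, (g₂ l).Unfinalized τ := forall_update_apply ⟨hfin, (hg₁ i).FIN_ne⟩ hg₁
  have hS₂ : CAS.Unfinalized τ S₂ := hS₁.updatePhase fun ht => absurd ht hfin
  have hFIN : FIN' ≠ τ := sup_ne (sup_ne (fsup_ne fun l => (hg₂ l).FIN_ne)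
    (hS₂.maxPhase_ne pre_notMem_lastPhase)) (fsup_ne fun l => (hg₂ l).fin_ne)
  have hg₃ : ∀ l, (g₃ l).Unfinalized τ := forall_update_apply ⟨(hg₂ i).fin_ne, hFIN⟩ hg₂
  have hS₃ : CAS.Unfinalized τ S₃ := hS₂.updatePhase fun ht => absurd ht hFIN
  exact ⟨hS₃, ⟨hS₃.maxPhase_ne pre_notMem_finPhases, hS₃.maxPhase_ne pre_notMem_lastPhase⟩, hg₃⟩

theorem Gossip.unfinalized_of_not_hasTag {g : Gossip N} (h : ¬ g.HasTag τ) : g.Unfinalized τ :=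
  ⟨fun hfin => h (Or.inr (Or.inl hfin)), fun hFIN => h (Or.inr (Or.inr hFIN))⟩

theorem Request.unfinalized_of_not_hasTag {q : Request N A} (h : ¬ q.HasTag τ) :
    q.Unfinalized τ := by
  cases q <;> trivial

theorem Server.unfinalized_of_not_hasTag {s : Server N A} (h : ¬ s.HasTag τ) :
    s.Unfinalized τ where
  store r hr htag := (h (Or.inl ⟨r, hr, htag⟩)).elim
  gossipTx := Gossip.unfinalized_of_not_hasTag fun hg => h (Or.inr (Or.inl hg))
  gossipRx l := Gossip.unfinalized_of_not_hasTag fun hg => h (Or.inr (Or.inr (Or.inl ⟨l, hg⟩)))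

end Unfinalized

/-! ### The effect of a step on one component -/

section Steps

variable {N k e : ℕ} {A : Type} {P : Params N k e A} {s s' : State N k A} {l : Label N k A}

/-- The effect of a step `l` from `s` to `s'` on the client at node `i`. -/
inductive ClientStep (P : Params N k e A) (s : State N k A) (l : Label N k A) (s' : State N k A)
    (i : Fin N) : Prop
  | unchanged (client : s'.client i = s.client i) (calls : s'.calls i = s.calls i)
  | ack (j : Fin N) (r : Reply N A) (wire : s.wire i j = .toClient (some (s.calls i, r)))
      (client : s'.client i = (s.client i).addAck j r) (calls : s'.calls i = s.calls i)
  | advance (label : l = .advance i) (busy : ¬ (s.client i).Idle)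
      (quorum : IsQuorum k e (ackSet (s.client i).acks))
      (client : s'.client i = (s.client i).advance P i) (calls : s'.calls i = s.calls i + 1)
  | invoke (op : Op k A) (label : l = .invoke i op) (idle : (s.client i).Idle)
      (client : s'.client i = .query op fun _ => none) (calls : s'.calls i = s.calls i + 1)

/-- The effect of a step from `s` to `s'` on the server at node `j`, except for its reply
buffers. -/
inductive ServerStep (P : Params N k e A) (s s' : State N k A) (j : Fin N) : Prop
  | unchanged (pongTx : Fin N → Option (ℕ × Reply N A))
      (server : s'.server j = { s.server j with pongTx := pongTx })
  | handle (i : Fin N) (n : ℕ) (q : Request N A) (pongTx : Fin N → Option (ℕ × Reply N A))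
      (wire : s.wire i j = .toServer (some (n, q)))
      (server : s'.server j = { s.server j with
        store := (handle (s.server j).store (P.code P.v₀ j) q).1
        pongTx := pongTx })
  | gossip (i : Fin N) (m : Gossip N) (wire : s.gossipWire i j = some m)
      (server : s'.server j = onGossip k e j i m (s.server j))

/-- The effect of a step `l` from `s` to `s'` on the token between client `i` and server `j`, and on
the buffer with the reply of this server to this client. -/
inductive TokenStep (P : Params N k e A) (s : State N k A) (l : Label N k A) (s' : State N k A)
    (i j : Fin N) : Prop
  | unchanged (wire' : s'.wire i j = s.wire i j)
      (buffer : (s'.server j).pongTx i = (s.server j).pongTx i)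
  | pingDepart (label : l = .pingDepart i j) (wire : s.wire i j = .atClient)
      (wire' : s'.wire i j = .toServer (((s.client i).request j).map fun q => (s.calls i, q)))
      (buffer : (s'.server j).pongTx i = (s.server j).pongTx i)
  | pingArriveEmpty (label : l = .pingArrive i j) (wire : s.wire i j = .toServer none)
      (wire' : s'.wire i j = .atServer) (buffer : (s'.server j).pongTx i = none)
  | pingArrive (n : ℕ) (q : Request N A) (r : Reply N A) (label : l = .pingArrive i j)
      (wire : s.wire i j = .toServer (some (n, q)))
      (mayReply : MayReply P j (handle (s.server j).store (P.code P.v₀ j) q).2 r)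
      (store : (s'.server j).store = (handle (s.server j).store (P.code P.v₀ j) q).1)
      (wire' : s'.wire i j = .atServer) (buffer : (s'.server j).pongTx i = some (n, r))
  | pongDepart (label : l = .pongDepart i j) (wire : s.wire i j = .atServer)
      (wire' : s'.wire i j = .toClient ((s.server j).pongTx i))
      (buffer : (s'.server j).pongTx i = (s.server j).pongTx i)
  | pongArrive (m : Option (ℕ × Reply N A)) (label : l = .pongArrive i j)
      (wire : s.wire i j = .toClient m) (wire' : s'.wire i j = .atClient)
      (buffer : (s'.server j).pongTx i = (s.server j).pongTx i)

theorem Step.client (h : Step P s l s') (i : Fin N) : ClientStep P s l s' i := by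
  cases h with
  | invoke i' op _ idle =>
    by_cases hi : i = i'
    · subst hi
      exact .invoke op rfl idle (Function.update_self ..) (Function.update_self ..)
    · exact .unchanged (Function.update_of_ne hi ..) (Function.update_of_ne hi ..)
  | advance i' _ busy quorum =>
    by_cases hi : i = i'
    · subst hi
      exact .advance rfl busy quorum (Function.update_self ..) (Function.update_self ..)
    · exact .unchanged (Function.update_of_ne hi ..) (Function.update_of_ne hi ..)
  | pongArrive i' j r _ wire =>
    by_cases hi : i = i'
    · subst hi
      exact .ack j r wire (Function.update_self ..) rfl
    · exact .unchanged (Function.update_of_ne hi ..) rfl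
  | _ => exact .unchanged rfl rfl

theorem Step.server (h : Step P s l s') (j : Fin N) : ServerStep P s s' j := by
  cases h with
  | pingArriveEmpty i j' _ wire =>
    by_cases hj : j = j'
    · subst hj
      exact .unchanged _ (Function.update_self ..)
    · exact .unchanged _ (Function.update_of_ne hj ..)
  | pingArrive i j' n q r _ wire =>
    by_cases hj : j = j'
    · subst hj
      exact .handle i n q (Function.update (s.server j).pongTx i (some (n, r))) wire
        (by simp [State.setWire, State.setPong, State.setStore, State.setServer])
    · exact .unchanged (s.server j).pongTx
        (by simp [State.setWire, State.setPong, State.setStore, State.setServer, hj])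
  | gossipArrive i j' m _ _ wire =>
    by_cases hj : j = j'
    · subst hj
      exact .gossip i m wire (Function.update_self ..)
    · exact .unchanged _ (Function.update_of_ne hj ..)
  | _ => exact .unchanged _ rfl

theorem State.setWire_wire (s : State N k A) (i j i' j' : Fin N) (w : Wire N A) :
    (s.setWire i j w).wire i' j' = if i' = i ∧ j' = j then w else s.wire i' j' := by
  by_cases hi : i' = i <;> by_cases hj : j' = j <;> simp [State.setWire, *]

theorem State.setPong_pongTx (s : State N k A) (i j i' j' : Fin N) (m : Option (ℕ × Reply N A)) :
    ((s.setPong j i m).server j').pongTx i' =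
      if i' = i ∧ j' = j then m else (s.server j').pongTx i' := by
  by_cases hi : i' = i <;> by_cases hj : j' = j <;>
    simp [State.setPong, State.setServer, *]

theorem State.setStore_pongTx (s : State N k A) (j j' : Fin N) (S : Finset (Record N A)) :
    ((s.setStore j S).server j').pongTx = (s.server j').pongTx := by
  by_cases hj : j' = j <;> simp [State.setStore, State.setServer, *]

theorem Step.token (h : Step P s l s') (i j : Fin N) : TokenStep P s l s' i j := by
  cases h with
  | pingDepart i' j' _ wire =>
    by_cases hij : i = i' ∧ j = j'
    · obtain ⟨rfl, rfl⟩ := hij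
      exact .pingDepart rfl wire (by simp [State.setWire_wire]) rfl
    · exact .unchanged (by rw [State.setWire_wire, if_neg hij]) rfl
  | pingArriveEmpty i' j' _ wire =>
    by_cases hij : i = i' ∧ j = j'
    · obtain ⟨rfl, rfl⟩ := hij
      refine .pingArriveEmpty rfl wire (by simp [State.setWire_wire]) ?_
      exact (State.setPong_pongTx ..).trans (if_pos ⟨rfl, rfl⟩)
    · refine .unchanged (by rw [State.setWire_wire, if_neg hij]; rfl) ?_
      exact (State.setPong_pongTx ..).trans (if_neg hij)
  | pingArrive i' j' n q r _ wire mayReply =>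
    by_cases hij : i = i' ∧ j = j'
    · obtain ⟨rfl, rfl⟩ := hij
      refine .pingArrive n q r rfl wire mayReply ?_ (by simp [State.setWire_wire]) ?_
      · simp [State.setWire, State.setPong, State.setStore, State.setServer]
      · exact (State.setPong_pongTx ..).trans (if_pos ⟨rfl, rfl⟩)
    · refine .unchanged (by rw [State.setWire_wire, if_neg hij]; rfl) ?_
      exact (State.setPong_pongTx ..).trans
        ((if_neg hij).trans (congrFun (State.setStore_pongTx ..) i))
  | pongDepart i' j' _ wire =>
    by_cases hij : i = i' ∧ j = j'
    · obtain ⟨rfl, rfl⟩ := hij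
      exact .pongDepart rfl wire (by simp [State.setWire_wire]) rfl
    · exact .unchanged (by rw [State.setWire_wire, if_neg hij]) rfl
  | pongArrive i' j' r _ wire | pongArriveOther i' j' m _ wire =>
    by_cases hij : i = i' ∧ j = j'
    · obtain ⟨rfl, rfl⟩ := hij
      exact .pongArrive _ rfl wire (by simp [State.setWire_wire]) rfl
    · exact .unchanged (by simp [State.setWire_wire, hij, State.setClient]) rfl
  | gossipArrive i' j' m =>
    refine .unchanged rfl ?_
    by_cases hj : j = j' <;>
      simp [State.setGossipWire, State.setServer, onGossip, hj]
  | _ => exact .unchanged rfl rfl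

theorem Step.gossipWire (h : Step P s l s') (i j : Fin N) :
    s'.gossipWire i j = s.gossipWire i j ∨ s'.gossipWire i j = some (s.server i).gossipTx ∨
      s'.gossipWire i j = none := by
  cases h with
  | gossipDepart i' j' | gossipArrive i' j' =>
    by_cases hi : i = i' <;> by_cases hj : j = j' <;>
      simp [State.setGossipWire, State.setServer, *]
  | _ => exact Or.inl rfl

theorem Step.persists (h : Step P s l s') (j : Fin N) :
    Persists (s.server j).store (s'.server j).store := by
  rcases h.server j with ⟨_, h⟩ | ⟨_, _, _, _, _, h⟩ | ⟨_, _, _, h⟩ <;> rw [h]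
  · exact .refl _
  · exact persists_handle _ _ _
  · exact persists_onGossip _ _ _ _ _ _

end Steps

/-! ### Calls of `qrmAccess` -/

section Calls

variable {N k e : ℕ} {A : Type} {P : Params N k e A} {s s' : State N k A} {l : Label N k A}

theorem Client.request_addAck (c : Client N k A) (j j' : Fin N) (r : Reply N A) :
    (c.addAck j r).request j' = c.request j' := by
  cases c <;> rfl

theorem Client.acks_addAck {c : Client N k A} {j j' : Fin N} {r r' : Reply N A}
    (h : (c.addAck j r).acks j' = some r') : (j' = j ∧ r' = r) ∨ c.acks j' = some r' := by
  by_cases hj : j' = j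
  · subst hj
    cases c <;> simp_all [Client.addAck, Client.acks]
  · cases c <;> simp_all [Client.addAck, Client.acks]

theorem Client.acks_advance (c : Client N k A) (i j : Fin N) : (c.advance P i).acks j = none := by
  rcases c with _ | ⟨_ | _, _⟩ | _ | _ | _ | _ <;> rfl

theorem Step.call (h : Step P s l s') (i : Fin N) :
    (s'.calls i = s.calls i ∧ ∀ j, (s'.client i).request j = (s.client i).request j) ∨
      (s'.calls i = s.calls i + 1 ∧ ∀ j, (s'.client i).acks j = none) := by
  rcases h.client i with ⟨hc, hn⟩ | ⟨_, _, _, hc, hn⟩ | ⟨_, _, _, hc, hn⟩ | ⟨_, _, _, hc, hn⟩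
  · exact Or.inl ⟨hn, fun _ => by rw [hc]⟩
  · exact Or.inl ⟨hn, fun _ => by rw [hc, Client.request_addAck]⟩
  · exact Or.inr ⟨hn, fun _ => by rw [hc, Client.acks_advance]⟩
  · exact Or.inr ⟨hn, fun _ => by rw [hc]; rfl⟩

theorem Step.calls_le (h : Step P s l s') (i : Fin N) : s.calls i ≤ s'.calls i := by
  rcases h.call i with ⟨hn, -⟩ | ⟨hn, -⟩ <;> omega

theorem Step.request_eq (h : Step P s l s') {i : Fin N} (hn : s'.calls i ≤ s.calls i) (j : Fin N) :
    (s'.client i).request j = (s.client i).request j := by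
  rcases h.call i with ⟨-, hc⟩ | ⟨hn', -⟩
  · exact hc j
  · omega

/-- No message belongs to a future call of `qrmAccess`, and those requests in transit that belong to
the current call of a client are the ones that this client makes. -/
structure State.Fresh (s : State N k A) : Prop where
  request_le : ∀ {i j n q}, s.wire i j = .toServer (some (n, q)) → n ≤ s.calls i
  request_eq : ∀ {i j q}, s.wire i j = .toServer (some (s.calls i, q)) →
    (s.client i).request j = some q
  buffer_le : ∀ {i j n r}, (s.server j).pongTx i = some (n, r) → n ≤ s.calls i
  reply_le : ∀ {i j n r}, s.wire i j = .toClient (some (n, r)) → n ≤ s.calls i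

theorem State.NoStaleMessages.fresh (h : s.NoStaleMessages) : s.Fresh where
  request_le {i j n q} hw := by rcases h.1 i j with h | h | h | h <;> simp [hw] at h
  request_eq {i j q} hw := by rcases h.1 i j with h | h | h | h <;> simp [hw] at h
  buffer_le hb := by simp [h.2] at hb
  reply_le {i j n r} hw := by rcases h.1 i j with h | h | h | h <;> simp [hw] at h

section

variable {i j : Fin N} {n : ℕ} {q : Request N A} {r : Reply N A}

theorem Step.request_le (h : Step P s l s') (hs : s.Fresh)
    (hw : s'.wire i j = .toServer (some (n, q))) : n ≤ s.calls i := by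
  cases h.token i j with
  | unchanged wire' => exact hs.request_le (wire' ▸ hw)
  | pingDepart _ _ wire' =>
    simp only [wire', Wire.toServer.injEq, Option.map_eq_some_iff, Prod.mk.injEq] at hw
    obtain ⟨_, _, rfl, _⟩ := hw
    exact le_rfl
  | _ => simp_all

theorem Step.buffer_le (h : Step P s l s') (hs : s.Fresh)
    (hb : (s'.server j).pongTx i = some (n, r)) : n ≤ s.calls i := by
  cases h.token i j with
  | pingArrive _ _ _ _ wire _ _ _ buffer =>
    cases buffer.symm.trans hb
    exact hs.request_le wire
  | pingArriveEmpty => simp_all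
  | unchanged _ buffer | pingDepart _ _ _ buffer | pongDepart _ _ _ buffer
  | pongArrive _ _ _ _ buffer => exact hs.buffer_le (buffer ▸ hb)

theorem Step.reply_le (h : Step P s l s') (hs : s.Fresh)
    (hw : s'.wire i j = .toClient (some (n, r))) : n ≤ s.calls i := by
  cases h.token i j with
  | unchanged wire' => exact hs.reply_le (wire' ▸ hw)
  | pongDepart _ _ wire' => exact hs.buffer_le (Wire.toClient.inj (wire'.symm.trans hw))
  | _ => simp_all

theorem Step.fresh (h : Step P s l s') (hs : s.Fresh) : s'.Fresh where
  request_le hw := (h.request_le hs hw).trans (h.calls_le _)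
  request_eq {i j q} hw := by
    have hn := h.request_le hs hw
    rw [h.request_eq hn]
    rw [le_antisymm hn (h.calls_le i)] at hw
    cases h.token i j with
    | unchanged wire' => exact hs.request_eq (wire' ▸ hw)
    | pingDepart _ _ wire' => simpa [wire'] using hw
    | _ => simp_all
  buffer_le hb := (h.buffer_le hs hb).trans (h.calls_le _)
  reply_le hw := (h.reply_le hs hw).trans (h.calls_le _)

/-- The reply `r` of server `j` to the current call of client `i` has been received, is in transit,
or waits in the buffer of the server. -/
def State.Replied (s : State N k A) (i j : Fin N) (r : Reply N A) : Prop :=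
  (s.client i).acks j = some r ∨ (s.server j).pongTx i = some (s.calls i, r) ∨
    s.wire i j = .toClient (some (s.calls i, r))

theorem Step.calls_eq_of_replied (h : Step P s l s') (hs : s.Fresh) (hr : s'.Replied i j r) :
    s'.calls i = s.calls i := by
  rcases hr with hr | hr | hr
  · rcases h.call i with ⟨hn, -⟩ | ⟨-, hc⟩
    · exact hn
    · simp [hc] at hr
  · exact le_antisymm (h.buffer_le hs hr) (h.calls_le i)
  · exact le_antisymm (h.reply_le hs hr) (h.calls_le i)

theorem Step.replied (h : Step P s l s') (hs : s.Fresh) (hr : s'.Replied i j r) :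
    s.Replied i j r ∨ ∃ q, (s.client i).request j = some q ∧
      MayReply P j (handle (s.server j).store (P.code P.v₀ j) q).2 r ∧
      (s'.server j).store = (handle (s.server j).store (P.code P.v₀ j) q).1 := by
  have hn := h.calls_eq_of_replied hs hr
  rcases hr with hr | hr | hr
  · rcases h.client i with ⟨hc, -⟩ | ⟨_, _, wire, hc, -⟩ | ⟨_, _, _, _, hn'⟩ | ⟨_, _, _, _, hn'⟩
    · exact Or.inl (Or.inl (hc ▸ hr))
    · rcases Client.acks_addAck (hc ▸ hr) with ⟨rfl, rfl⟩ | hr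
      · exact Or.inl (Or.inr (Or.inr wire))
      · exact Or.inl (Or.inl hr)
    all_goals omega
  · rw [hn] at hr
    cases h.token i j with
    | pingArrive _ _ _ _ wire mayReply store _ buffer =>
      cases buffer.symm.trans hr
      exact Or.inr ⟨_, hs.request_eq wire, mayReply, store⟩
    | pingArriveEmpty => simp_all
    | unchanged _ buffer | pingDepart _ _ _ buffer | pongDepart _ _ _ buffer
    | pongArrive _ _ _ _ buffer => exact Or.inl (Or.inr (Or.inl (buffer ▸ hr)))
  · rw [hn] at hr
    cases h.token i j with
    | unchanged wire' => exact Or.inl (Or.inr (Or.inr (wire' ▸ hr)))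
    | pongDepart _ _ wire' =>
      exact Or.inl (Or.inr (Or.inl (Wire.toClient.inj (wire'.symm.trans hr))))
    | _ => simp_all

end

namespace Execution

variable (R : Execution P)

theorem calls_mono (i : Fin N) : Monotone fun n => (R.state n).calls i :=
  monotone_nat_of_le_succ fun n => (R.step n).calls_le i

theorem persists {m n : ℕ} (h : m ≤ n) (j : Fin N) :
    Persists ((R.state m).server j).store ((R.state n).server j).store := by
  induction n, h using Nat.le_induction with
  | base => exact .refl _
  | succ n _ ih => exact ih.trans ((R.step n).persists j)

variable {R} {i j : Fin N} {m n : ℕ}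

theorem fresh (h : (R.state 0).Fresh) (n : ℕ) : (R.state n).Fresh := by
  induction n with
  | zero => exact h
  | succ n ih => exact (R.step n).fresh ih

theorem request_eq_of_calls_eq (hmn : m ≤ n) (h : (R.state m).calls i = (R.state n).calls i)
    (j : Fin N) : ((R.state n).client i).request j = ((R.state m).client i).request j := by
  induction n, hmn using Nat.le_induction with
  | base => rfl
  | succ n hmn ih =>
    have hm : (R.state m).calls i ≤ (R.state n).calls i := R.calls_mono i hmn
    have hn := (R.step n).calls_le i
    rw [(R.step n).request_eq (by omega), ih (by omega)]

theorem exists_handled (hR : (R.state 0).Fresh)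
    (hcalls : (R.state m).calls i < (R.state n).calls i) {q : Request N A}
    (hq : ((R.state n).client i).request j = some q) {r : Reply N A}
    (hr : (R.state n).Replied i j r) :
    ∃ p, m ≤ p ∧ p < n ∧
      MayReply P j (handle ((R.state p).server j).store (P.code P.v₀ j) q).2 r ∧
      ((R.state (p + 1)).server j).store =
        (handle ((R.state p).server j).store (P.code P.v₀ j) q).1 := by
  induction n with
  | zero => exact absurd hcalls (R.calls_mono i (Nat.zero_le m)).not_gt
  | succ n ih =>
    have hn := (R.step n).calls_eq_of_replied (fresh hR n) hr
    rw [hn] at hcalls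
    rw [(R.step n).request_eq hn.le] at hq
    rcases (R.step n).replied (fresh hR n) hr with hr | ⟨q', hq', hhandled⟩
    · obtain ⟨p, hmp, hpn, hhandled⟩ := ih hcalls hq hr
      exact ⟨p, hmp, by omega, hhandled⟩
    · cases hq'.symm.trans hq
      exact ⟨n, ((R.calls_mono i).reflect_lt hcalls).le, by omega, hhandled⟩

theorem le_maxTag_of_quorum (hR : (R.state 0).Fresh) (hk : 1 ≤ k) {op : Op k A} {acks : Acks N A}
    (hc : (R.state n).client i = .query op acks)
    (hcalls : (R.state m).calls i < (R.state n).calls i) (hacks : IsQuorum k e (ackSet acks))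
    {t : Tag₀ N} {Q : Finset (Fin N)} (hQ : IsQuorum k e Q)
    (ht : ∀ j ∈ Q, t ≤ maxPhase ((R.state m).server j).store op.role.phases) :
    t ≤ maxTag acks := by
  obtain ⟨j, hj⟩ := hacks.inter_nonempty hk hQ
  obtain ⟨hja, hjQ⟩ := Finset.mem_inter.1 hj
  obtain ⟨r, hr⟩ := mem_ackSet.1 hja
  obtain ⟨p, hmp, -, hreply, -⟩ := exists_handled (q := .query op.role) hR hcalls
    (by rw [hc]; rfl) (Or.inl (by rw [hc]; exact hr))
  calc t ≤ maxPhase ((R.state m).server j).store op.role.phases := ht j hjQ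
    _ ≤ maxPhase ((R.state p).server j).store op.role.phases := (R.persists hmp j).maxPhase_le _
    _ = r.tag := by rw [hreply.1, handle_query]
    _ ≤ maxTag acks := le_maxTag hr

end Execution

end Calls

/-! ### The life cycle of a tag -/

section LifeCycle

variable {N k e : ℕ} {A : Type} {P : Params N k e A} {s s' : State N k A} {l : Label N k A}
  {τ : Tag N} {v v' : Fin k → A}

theorem Step.of_advance {i : Fin N} (h : Step P s (.advance i) s') :
    IsQuorum k e (ackSet (s.client i).acks) ∧ s'.client i = (s.client i).advance P i ∧
      s'.calls i = s.calls i + 1 := by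
  cases h with
  | advance _ _ _ quorum => exact ⟨quorum, Function.update_self .., Function.update_self ..⟩

/-- The tag `τ` is finalized nowhere, and no message in transit can lead to its finalization. -/
structure State.Unfinalized (τ : Tag N) (s : State N k A) : Prop where
  server : ∀ j, (s.server j).Unfinalized τ
  gossip : ∀ {i j g}, s.gossipWire i j = some g → g.Unfinalized τ
  wire : ∀ {i j n q}, s.wire i j = .toServer (some (n, q)) → q.Unfinalized τ
  client : ∀ {i j q}, (s.client i).request j = some q → q.Unfinalized τ
  reply : ∀ {i j r}, (s.client i).request j = some (.query .reader) → s.Replied i j r → r.tag ≠ τ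

theorem State.Unfinalized.request_advance (hs : s.Unfinalized τ) {i j : Fin N}
    (hc : ∀ words acks, s.client i ≠ .prewrite τ words acks) {q : Request N A}
    (hq : ((s.client i).advance P i).request j = some q) : q.Unfinalized τ := by
  rcases hcl : s.client i with _ | ⟨_ | _, a⟩ | ⟨t, ws, a⟩ | ⟨t, a⟩ | _ | _ <;>
    rw [hcl] at hq <;> cases hq
  · exact maxTag_ne fun j r hr =>
      hs.reply (i := i) (j := j) (by rw [hcl]; rfl) (Or.inl (by rw [hcl]; exact hr))
  · trivial
  · intro ht
    rw [WithBot.coe_inj.1 ht] at hcl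
    exact hc ws a hcl
  · have ht : (t : Tag₀ N) ≠ τ :=
      hs.client (i := i) (j := j) (q := .finalize .writer t) (by rw [hcl]; rfl)
    exact fun h => ht (congrArg _ h)

theorem Step.unfinalized (h : Step P s l s') (hs : s.Fresh) (hτ : s.Unfinalized τ)
    (hc : ∀ i words acks, l = .advance i → s.client i ≠ .prewrite τ words acks) :
    s'.Unfinalized τ where
  server j := by
    rcases h.server j with ⟨_, h⟩ | ⟨_, _, _, _, hw, h⟩ | ⟨_, _, hg, h⟩ <;> rw [h]
    · exact ⟨(hτ.server j).store, (hτ.server j).gossipTx, (hτ.server j).gossipRx⟩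
    · exact ⟨(hτ.server j).store.handle _ (hτ.wire hw), (hτ.server j).gossipTx,
        (hτ.server j).gossipRx⟩
    · exact (hτ.server j).onGossip _ _ _ _ (hτ.gossip hg)
  gossip {i j g} hg := by
    rcases h.gossipWire i j with h | h | h <;> rw [h] at hg
    · exact hτ.gossip hg
    · cases hg
      exact (hτ.server i).gossipTx
    · cases hg
  wire {i j n q} hw := by
    cases h.token i j with
    | unchanged wire' => exact hτ.wire (wire' ▸ hw)
    | pingDepart _ _ wire' =>
      simp only [wire', Wire.toServer.injEq, Option.map_eq_some_iff, Prod.mk.injEq] at hw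
      obtain ⟨q', hq', -, rfl⟩ := hw
      exact hτ.client hq'
    | _ => simp_all
  client {i j q} hq := by
    rcases h.client i with ⟨h, -⟩ | ⟨_, _, _, h, -⟩ | ⟨hl, _, _, h, -⟩ | ⟨_, _, _, h, -⟩ <;>
      rw [h] at hq
    · exact hτ.client hq
    · rw [Client.request_addAck] at hq
      exact hτ.client hq
    · exact hτ.request_advance (fun _ _ => hc i _ _ hl) hq
    · cases hq
      trivial
  reply {i j r} hq hr := by
    rw [h.request_eq (h.calls_eq_of_replied hs hr).le] at hq
    rcases h.replied hs hr with hr | ⟨q, hq', hr, -⟩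
    · exact hτ.reply hq hr
    · cases hq'.symm.trans hq
      rw [hr.1]
      exact (hτ.server j).store.maxPhase_ne pre_notMem_finPhases

/-- All coded elements for the tag `τ`, those in transit included, are the ones of the value `v`,
and only the client that `τ` names pre-writes with it. -/
structure State.Carries (P : Params N k e A) (τ : Tag N) (v : Fin k → A) (s : State N k A) :
    Prop where
  store : ∀ j, OnlyWord τ (P.code v j) (s.server j).store
  wire : ∀ {i j n w}, s.wire i j = .toServer (some (n, .prewrite τ w)) → w = some (P.code v j)
  client : ∀ {i words acks}, s.client i = .prewrite τ words acks →
    i = (ofLex τ).2 ∧ words = fun j => some (P.code v j)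

/-- The step `l` from the state `s` is the one in which a writer of the value `v` chooses the tag
`τ`. -/
def Creates (s : State N k A) (l : Label N k A) (τ : Tag N) (v : Fin k → A) : Prop :=
  ∃ i acks, l = .advance i ∧ s.client i = .query (.write v) acks ∧ nextTag (maxTag acks) i = τ

theorem Creates.unique (h : Creates s l τ v) (h' : Creates s l τ v') : v = v' := by
  obtain ⟨i, acks, rfl, hc, -⟩ := h
  obtain ⟨i', acks', hl, hc', -⟩ := h'
  cases hl
  cases hc.symm.trans hc'
  rfl

theorem Step.eq_prewrite (h : Step P s l s') {i : Fin N} {words : Fin N → Option A}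
    {acks : Acks N A} (hc : s'.client i = .prewrite τ words acks) :
    (∃ acks', s.client i = .prewrite τ words acks') ∨
      ∃ v, Creates s l τ v ∧ i = (ofLex τ).2 ∧ words = fun j => some (P.code v j) := by
  rcases h.client i with ⟨h, -⟩ | ⟨_, _, _, h, -⟩ | ⟨hl, _, _, h, -⟩ | ⟨_, _, _, h, -⟩ <;>
    rw [h] at hc
  · exact Or.inl ⟨acks, hc⟩
  · left
    cases hcl : s.client i <;> rw [hcl] at hc <;> cases hc
    exact ⟨_, rfl⟩
  · right
    rcases hcl : s.client i with _ | ⟨_ | v, a⟩ | _ | _ | _ | _ <;> rw [hcl] at hc <;> cases hc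
    exact ⟨v, ⟨i, a, hl, hcl, rfl⟩, (nextTag_snd _ i).symm, rfl⟩
  · cases hc

theorem Step.carries (h : Step P s l s') (hv : s.Carries P τ v)
    (hcreates : ∀ v', Creates s l τ v' → v' = v) : s'.Carries P τ v where
  store j := by
    rcases h.server j with ⟨_, h⟩ | ⟨_, _, _, _, hw, h⟩ | ⟨_, _, _, h⟩ <;> rw [h]
    · exact hv.store j
    · exact (hv.store j).handle _ fun w hq => hv.wire (hq ▸ hw)
    · exact (hv.store j).onGossip _ _ _ _ _
  wire {i j n w} hw := by
    cases h.token i j with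
    | unchanged wire' => exact hv.wire (wire' ▸ hw)
    | pingDepart _ _ wire' =>
      simp only [wire', Wire.toServer.injEq, Option.map_eq_some_iff, Prod.mk.injEq] at hw
      obtain ⟨q, hq, -, rfl⟩ := hw
      cases hcl : s.client i <;> rw [hcl] at hq <;> cases hq
      rw [(hv.client hcl).2]
    | _ => simp_all
  client hc := by
    rcases h.eq_prewrite hc with ⟨acks', hc⟩ | ⟨v', hv', hi, hwords⟩
    · exact hv.client hc
    · exact ⟨hi, hcreates v' hv' ▸ hwords⟩

/-- The tag `τ` is not finalized, no client pre-writes with it, and the coded elements for it (if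
any) are the ones of every value, so that they fit whichever value a writer later gives to `τ`. -/
structure State.Unused (P : Params N k e A) (τ : Tag N) (s : State N k A) : Prop where
  unfinalized : s.Unfinalized τ
  carries : ∀ v, s.Carries P τ v
  client : ∀ {i words acks}, s.client i ≠ .prewrite τ words acks

theorem State.unfinalized_of_not_hasTag (h : ¬ s.HasTag τ) : s.Unfinalized τ where
  server j := Server.unfinalized_of_not_hasTag fun hτ => h (Or.inr (Or.inl ⟨j, hτ⟩))
  gossip {i j g} hg := Gossip.unfinalized_of_not_hasTag fun hτ =>
    h (Or.inr (Or.inr (Or.inr ⟨i, j, g, hg, hτ⟩)))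
  wire {i j n q} hw := Request.unfinalized_of_not_hasTag fun hτ =>
    h (Or.inr (Or.inr (Or.inl ⟨i, j, by rw [hw]; exact ⟨n, q, rfl, hτ⟩⟩)))
  client {i j q} hq := Request.unfinalized_of_not_hasTag fun hτ =>
    h (Or.inl ⟨i, Or.inl ⟨j, q, hq, hτ⟩⟩)
  reply {i j r} _ hr hτ := by
    rcases hr with hr | hr | hr
    · exact h (Or.inl ⟨i, Or.inr ⟨j, r, hr, hτ⟩⟩)
    · exact h (Or.inr (Or.inl ⟨j, Or.inr (Or.inr (Or.inr ⟨i, _, r, hr, hτ⟩))⟩))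
    · exact h (Or.inr (Or.inr (Or.inl ⟨i, j, by rw [hr]; exact ⟨_, r, rfl, hτ⟩⟩)))

theorem State.unused_of_not_hasTag (h : ¬ s.HasTag τ) : s.Unused P τ := by
  have hclient : ∀ {i words acks}, s.client i ≠ .prewrite τ words acks := fun {i words acks} hc =>
    h (Or.inl ⟨i, Or.inl ⟨i, .prewrite τ (words i), by rw [hc]; rfl, rfl⟩⟩)
  refine ⟨State.unfinalized_of_not_hasTag h, fun v => ⟨fun j r hr hτ => ?_, ?_, ?_⟩, hclient⟩
  · exact (h (Or.inr (Or.inl ⟨j, Or.inl ⟨r, hr, hτ⟩⟩))).elim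
  · exact fun {i j n w} hw =>
      (h (Or.inr (Or.inr (Or.inl ⟨i, j, by rw [hw]; exact ⟨n, _, rfl, rfl⟩⟩)))).elim
  · exact fun hc => (hclient hc).elim

theorem State.Safe.not_hasTag (h : s.Safe) (τ : Tag N) : ¬ s.HasTag τ := by
  obtain ⟨⟨hwire, hpong⟩, hidle, hgossip, hserver⟩ := h
  have hdefault : ¬ (Gossip.default : Gossip N).HasTag τ := by
    rintro (h | h | h) <;> exact WithBot.bot_ne_coe h
  rintro (⟨i, h⟩ | ⟨j, h⟩ | ⟨i, j, h⟩ | ⟨i, j, g, hg, h⟩)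
  · have hi := hidle i
    cases hc : s.client i <;> rw [hc] at hi h
    · rcases h with ⟨_, _, h, -⟩ | ⟨_, _, h, -⟩ <;> cases h
    all_goals exact hi
  · obtain ⟨hstore, hTx, hRx⟩ := hserver j
    rcases h with ⟨r, hr, -⟩ | h | ⟨l, h⟩ | ⟨i, n, r, h, -⟩
    · simp [hstore] at hr
    · exact hdefault (hTx ▸ h)
    · exact hdefault (hRx l ▸ h)
    · simp [hpong] at h
  · rcases hwire i j with hw | hw | hw | hw <;> simp [hw, Wire.HasTag] at h
  · rcases hgossip i j with hg' | hg' <;> cases hg'.symm.trans hg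
    exact hdefault h

namespace Execution

variable {R : Execution P} {m n : ℕ}

theorem step_of_label_eq (h : R.label n = l) : Step P (R.state n) l (R.state (n + 1)) :=
  h ▸ R.step n

theorem IsVersion.mono {t : Tag₀ N} (h : R.IsVersion m t v) (hmn : m ≤ n) :
    R.IsVersion n t v :=
  h.imp_right fun ⟨p, hp, hc⟩ => ⟨p, hp.trans hmn, hc⟩

/-- In the `n`-th state, a writer is in the pre-write phase of `v` with the tag `τ`, which has not
yet been finalized. -/
structure PreWriting (R : Execution P) (τ : Tag N) (v : Fin k → A) (n : ℕ) : Prop where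
  carries : (R.state n).Carries P τ v
  unfinalized : (R.state n).Unfinalized τ
  started : ∃ m, (R.state m).calls (ofLex τ).2 < (R.state n).calls (ofLex τ).2
  client : ∃ acks,
    (R.state n).client (ofLex τ).2 = .prewrite τ (fun j => some (P.code v j)) acks

/-- By the `n`-th state, a writer has completed its pre-write phase of `v` with the tag `τ`. The
last clause, on its client in the state `p`, makes every later query of this client a new one. -/
structure PreWritten (R : Execution P) (τ : Tag N) (v : Fin k → A) (n : ℕ) : Prop where
  isVersion : R.IsVersion n τ v
  carries : (R.state n).Carries P τ v
  quorum : ∃ p ≤ n, ∃ Q, IsQuorum k e Q ∧ (∀ j ∈ Q, HoldsWord ((R.state p).server j).store τ) ∧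
    ∀ j, ((R.state p).client (ofLex τ).2).request j ≠ some (.query .writer)

theorem preWriting_of_creates (hR : (R.state 0).Fresh) (hn : (R.state n).Unused P τ)
    (hv : Creates (R.state n) (R.label n) τ v) : R.PreWriting τ v (n + 1) := by
  have ⟨i, acks, hl, hc, hτ⟩ := hv
  obtain ⟨-, hc', hcalls⟩ := (step_of_label_eq hl).of_advance
  obtain rfl : i = (ofLex τ).2 := by rw [← hτ, nextTag_snd]
  refine ⟨(R.step n).carries (hn.carries v) fun _ hv' => hv'.unique hv,
    (R.step n).unfinalized (fresh hR n) hn.unfinalized fun _ _ _ _ => hn.client,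
    ⟨n, by omega⟩, fun _ => none, ?_⟩
  rw [hc', hc]
  change Client.prewrite (nextTag (maxTag acks) _) _ _ = _
  rw [hτ]

theorem unused_succ_or_preWriting (hR : (R.state 0).Fresh) (hn : (R.state n).Unused P τ) :
    (R.state (n + 1)).Unused P τ ∨ ∃ v, R.PreWriting τ v (n + 1) := by
  by_cases hcreates : ∃ v, Creates (R.state n) (R.label n) τ v
  · obtain ⟨v, hv⟩ := hcreates
    exact Or.inr ⟨v, preWriting_of_creates hR hn hv⟩
  · refine Or.inl ⟨(R.step n).unfinalized (fresh hR n) hn.unfinalized fun _ _ _ _ => hn.client,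
      fun v => (R.step n).carries (hn.carries v) fun v' hv' => (hcreates ⟨v', hv'⟩).elim,
      fun hc => ?_⟩
    rcases (R.step n).eq_prewrite hc with ⟨_, hc⟩ | ⟨v, hv, -⟩
    · exact hn.client hc
    · exact hcreates ⟨v, hv⟩

theorem PreWriting.carries_succ (h : R.PreWriting τ v n) :
    (R.state (n + 1)).Carries P τ v := by
  refine (R.step n).carries h.carries ?_
  rintro v' ⟨i, acks', -, hc', rfl⟩
  obtain ⟨acks, hc⟩ := h.client
  rw [nextTag_snd] at hc
  cases hc'.symm.trans hc

theorem PreWriting.isVersion (h : R.PreWriting τ v n) : R.IsVersion n τ v :=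
  let ⟨acks, hc⟩ := h.client
  Or.inr ⟨n, le_rfl, _, τ, acks, rfl, hc⟩

theorem PreWriting.preWritten (hR : (R.state 0).Fresh) (h : R.PreWriting τ v n)
    (hl : R.label n = .advance (ofLex τ).2) : R.PreWritten τ v (n + 1) := by
  obtain ⟨hQ, hc', -⟩ := (step_of_label_eq hl).of_advance
  obtain ⟨m, hm⟩ := h.started
  obtain ⟨acks, hc⟩ := h.client
  rw [hc] at hQ hc'
  refine ⟨h.isVersion.mono n.le_succ, h.carries_succ, n + 1, le_rfl, _, hQ, fun j hj => ?_,
    fun j => by simp [hc', Client.advance, Client.request]⟩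
  obtain ⟨r, hr⟩ := mem_ackSet.1 hj
  obtain ⟨p, -, hpn, -, hstore⟩ := exists_handled (q := .prewrite τ (some (P.code v j))) hR hm
    (by rw [hc]; rfl) (Or.inl (by rw [hc]; exact hr))
  have hp : HoldsWord ((R.state (p + 1)).server j).store τ := by
    rw [hstore]
    exact holdsWord_updatePhase _ _ _ _
  exact hp.of_persists (R.persists (by omega) j)

theorem PreWriting.succ (hR : (R.state 0).Fresh) (h : R.PreWriting τ v n) :
    R.PreWriting τ v (n + 1) ∨ R.PreWritten τ v (n + 1) := by
  by_cases hl : R.label n = .advance (ofLex τ).2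
  · exact Or.inr (h.preWritten hR hl)
  obtain ⟨m, hm⟩ := h.started
  obtain ⟨acks, hc⟩ := h.client
  refine Or.inl ⟨h.carries_succ, (R.step n).unfinalized (fresh hR n) h.unfinalized ?_,
    ⟨m, hm.trans_le ((R.step n).calls_le _)⟩, ?_⟩
  · intro i words acks hl' hc'
    rw [(h.carries.client hc').1] at hl'
    exact hl hl'
  · rcases (R.step n).client (ofLex τ).2 with
      ⟨hc', -⟩ | ⟨_, _, _, hc', -⟩ | ⟨hl', _, _, _, _⟩ | ⟨_, _, hidle, _, _⟩
    · exact ⟨acks, hc'.trans hc⟩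
    · exact ⟨_, by rw [hc', hc]; rfl⟩
    · exact absurd hl' hl
    · rw [hc] at hidle
      exact hidle.elim

theorem PreWritten.not_creates (hk : 1 ≤ k) (hR : (R.state 0).Fresh) (h : R.PreWritten τ v n) :
    ¬ Creates (R.state n) (R.label n) τ v' := by
  rintro ⟨i, acks, hl, hc, rfl⟩
  obtain ⟨p, hp, Q, hQ, hword, hq⟩ := h.quorum
  rw [nextTag_snd] at hq
  have hcalls : (R.state p).calls i < (R.state n).calls i :=
    (R.calls_mono i hp).lt_of_ne fun heq =>
      hq i (by rw [← request_eq_of_calls_eq hp heq, hc]; rfl)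
  obtain ⟨hacks, -, -⟩ := (step_of_label_eq hl).of_advance
  rw [hc] at hacks
  exact (lt_nextTag _ i).not_ge
    (le_maxTag_of_quorum hR hk hc hcalls hacks hQ fun j hj => (hword j hj).le_maxPhase)

theorem PreWritten.succ (hk : 1 ≤ k) (hR : (R.state 0).Fresh) (h : R.PreWritten τ v n) :
    R.PreWritten τ v (n + 1) where
  isVersion := h.isVersion.mono n.le_succ
  carries := (R.step n).carries h.carries fun _ hv' => (h.not_creates hk hR hv').elim
  quorum := let ⟨p, hp, hQ⟩ := h.quorum; ⟨p, hp.trans n.le_succ, hQ⟩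

theorem PreWritten.mono (hk : 1 ≤ k) (hR : (R.state 0).Fresh) (h : R.PreWritten τ v m)
    (hmn : m ≤ n) : R.PreWritten τ v n :=
  Nat.le_induction h (fun _ _ h => h.succ hk hR) n hmn

theorem unused_or_preWriting_or_preWritten (hk : 1 ≤ k) (hR : (R.state 0).Fresh)
    (hm : (R.state m).Unused P τ) (hmn : m ≤ n) :
    (R.state n).Unused P τ ∨ ∃ v, R.PreWriting τ v n ∨ R.PreWritten τ v n := by
  induction n, hmn using Nat.le_induction with
  | base => exact Or.inl hm
  | succ n _ ih =>
    rcases ih with h | ⟨v, h | h⟩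
    · exact (unused_succ_or_preWriting hR h).imp_right fun ⟨v, hv⟩ => ⟨v, Or.inl hv⟩
    · exact Or.inr ⟨v, h.succ hR⟩
    · exact Or.inr ⟨v, Or.inr (h.succ hk hR)⟩

theorem exists_preWritten (hk : 1 ≤ k) (hR : (R.state 0).Fresh) (hm : ¬ (R.state m).HasTag τ)
    (hmn : m ≤ n) (hn : ¬ (R.state n).Unfinalized τ) : ∃ v, R.PreWritten τ v n := by
  rcases unused_or_preWriting_or_preWritten hk hR (State.unused_of_not_hasTag hm) hmn with
    h | ⟨v, h | h⟩
  · exact absurd h.unfinalized hn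
  · exact absurd h.unfinalized hn
  · exact ⟨v, h⟩

end Execution

end LifeCycle

/-! ### Read and write operations -/

section Operations

variable {N k e : ℕ} {A : Type} {P : Params N k e A} {s s' : State N k A} {l : Label N k A}

theorem Step.of_invoke {i : Fin N} {op : Op k A} (h : Step P s (.invoke i op) s') :
    s'.client i = .query op (fun _ => none) ∧ s'.calls i = s.calls i + 1 := by
  cases h with
  | invoke => exact ⟨Function.update_self .., Function.update_self ..⟩

theorem Client.idle_addAck {c : Client N k A} {j : Fin N} {r : Reply N A} :
    (c.addAck j r).Idle ↔ c.Idle := by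
  cases c <;> rfl

theorem Step.of_return (h : Step P s l s') {i : Fin N} (hbusy : ¬ (s.client i).Idle)
    (hidle : (s'.client i).Idle) :
    IsQuorum k e (ackSet (s.client i).acks) ∧ s'.client i = (s.client i).advance P i := by
  rcases h.client i with ⟨hc, -⟩ | ⟨_, _, _, hc, -⟩ | ⟨_, _, hQ, hc, -⟩ | ⟨_, _, _, hc, -⟩
  · exact absurd (hc ▸ hidle) hbusy
  · exact absurd (Client.idle_addAck.1 (hc ▸ hidle)) hbusy
  · exact ⟨hQ, hc⟩
  · exact (hc ▸ hidle : Client.Idle (.query ..)).elim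

namespace Execution

variable {R : Execution P} {i j : Fin N} {a b m n : ℕ} {t : Tag₀ N} {v : Fin k → A}
  {acks : Acks N A}

theorem calls_lt_of_invoke {op : Op k A} (ha : R.label a = .invoke i op) (han : a < n) :
    (R.state a).calls i < (R.state n).calls i := by
  have hcalls := (step_of_label_eq ha).of_invoke.2
  have hmono : (R.state (a + 1)).calls i ≤ (R.state n).calls i := R.calls_mono i han
  omega

theorem CompleteOp.read_phases (h : R.CompleteOp i .read a b) (han : a < n) (hnb : n ≤ b) :
    (∃ acks, (R.state n).client i = .query .read acks) ∨
    ∃ c acks₀ acks, a < c ∧ c < n ∧ (R.state c).client i = .query .read acks₀ ∧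
      IsQuorum k e (ackSet acks₀) ∧
      (R.state (c + 1)).client i = .finalizeR (maxTag acks₀) (fun _ => none) ∧
      (R.state n).client i = .finalizeR (maxTag acks₀) acks := by
  obtain ⟨-, ha, hbusy, -⟩ := h
  induction n, (Nat.succ_le_of_lt han) using Nat.le_induction with
  | base => exact Or.inl ⟨_, (step_of_label_eq ha).of_invoke.1⟩
  | succ n hn ih =>
    rcases (R.step n).client i with
      ⟨h', -⟩ | ⟨_, _, _, h', -⟩ | ⟨_, _, hQ, h', -⟩ | ⟨_, _, hidle, _, _⟩
    · rw [h']
      exact (ih hn (by omega)).imp_right fun ⟨c, acks₀, acks, hac, hcn, h⟩ =>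
        ⟨c, acks₀, acks, hac, by omega, h⟩
    · rcases ih hn (by omega) with ⟨acks, h⟩ | ⟨c, acks₀, acks, hac, hcn, hc, hQ, hc', h⟩
      · exact Or.inl ⟨_, by rw [h', h]; rfl⟩
      · exact Or.inr ⟨c, acks₀, _, hac, by omega, hc, hQ, hc', by rw [h', h]; rfl⟩
    · rcases ih hn (by omega) with ⟨acks, h⟩ | ⟨_, _, _, _, _, _, _, _, h⟩
      · rw [h] at hQ h'
        exact Or.inr ⟨n, acks, _, hn, by omega, h, hQ, h', h'⟩
      · have hreturned := hbusy (n + 1) han hnb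
        rw [h', h] at hreturned
        exact absurd trivial hreturned
    · exact absurd hidle (hbusy n hn (by omega))

theorem CompleteOp.exists_finalizeR (h : R.CompleteOp i .read a b) :
    ∃ c acks₀ acks, a < c ∧ c < b ∧ (R.state c).client i = .query .read acks₀ ∧
      IsQuorum k e (ackSet acks₀) ∧
      (R.state (c + 1)).client i = .finalizeR (maxTag acks₀) (fun _ => none) ∧
      (R.state b).client i = .finalizeR (maxTag acks₀) acks ∧ IsQuorum k e (ackSet acks) ∧
      (R.state (b + 1)).client i = .idle (decode e P.code (ackWord (maxTag acks₀) acks)) := by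
  obtain ⟨hab, -, hbusy, hidle⟩ := id h
  obtain ⟨hQ, hb⟩ := (R.step b).of_return (hbusy b hab le_rfl) hidle
  rcases h.read_phases hab le_rfl with
    ⟨acks, hc⟩ | ⟨c, acks₀, acks, hac, hcb, hc, hQ₀, hc', hcl⟩
  · rw [hb, hc] at hidle
    exact hidle.elim
  · rw [hcl] at hQ hb
    exact ⟨c, acks₀, acks, hac, hcb, hc, hQ₀, hc', hcl, hQ, hb⟩

theorem CompleteOp.exists_finalizeW (h : R.CompleteOp i (.write v) a b) (han : a < n)
    (hnb : n ≤ b) {τ : Tag N} (hc : (R.state n).client i = .finalizeAgainW τ acks) :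
    ∃ c acks₀, a < c ∧ c < n ∧ (R.state c).client i = .finalizeW τ acks₀ ∧
      IsQuorum k e (ackSet acks₀) := by
  obtain ⟨-, ha, -, -⟩ := h
  induction n, (Nat.succ_le_of_lt han) using Nat.le_induction generalizing acks with
  | base => cases (step_of_label_eq ha).of_invoke.1.symm.trans hc
  | succ n hn ih =>
    have hprev {acks'} (hc' : (R.state n).client i = .finalizeAgainW τ acks') :
        ∃ c acks₀, a < c ∧ c < n + 1 ∧ (R.state c).client i = .finalizeW τ acks₀ ∧
          IsQuorum k e (ackSet acks₀) :=
      let ⟨c, acks₀, hac, hcn, h⟩ := ih hn (by omega) hc'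
      ⟨c, acks₀, hac, by omega, h⟩
    rcases (R.step n).client i with
      ⟨h', -⟩ | ⟨_, _, _, h', -⟩ | ⟨_, _, hQ, h', -⟩ | ⟨_, _, _, h', -⟩ <;> rw [h'] at hc
    · exact hprev hc
    · cases hcl : (R.state n).client i <;> rw [hcl] at hc <;> cases hc
      exact hprev hcl
    · rcases hcl : (R.state n).client i with _ | ⟨_ | _, _⟩ | _ | ⟨_, acks₀⟩ | _ | _ <;>
        rw [hcl] at hc hQ <;> cases hc
      exact ⟨n, acks₀, hn, n.lt_succ_self, hcl, hQ⟩
    · cases hc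

theorem exists_quorum_finalized (hR : (R.state 0).Fresh) (h : R.CompleteOp i (.write v) a b)
    {τ : Tag N} (hb : (R.state b).client i = .finalizeAgainW τ acks) :
    ∃ Q, IsQuorum k e Q ∧ ∀ j ∈ Q, τ ≤ maxPhase ((R.state b).server j).store finPhases := by
  obtain ⟨c, acks₀, hac, hcb, hc, hQ⟩ := h.exists_finalizeW h.1 le_rfl hb
  refine ⟨_, hQ, fun j hj => ?_⟩
  obtain ⟨r, hr⟩ := mem_ackSet.1 hj
  obtain ⟨p, -, hpc, -, hstore⟩ := exists_handled (q := .finalize .writer τ) hR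
    (calls_lt_of_invoke h.2.1 hac) (by rw [hc]; rfl) (Or.inl (by rw [hc]; exact hr))
  calc (τ : Tag₀ N) ≤ maxPhase ((R.state (p + 1)).server j).store finPhases := by
        rw [hstore]
        exact le_maxPhase_updatePhase_fin _ _ _
    _ ≤ maxPhase ((R.state b).server j).store finPhases :=
        (R.persists (by omega) j).maxPhase_le .reader

/-- From the `n`-th state on, the value `v` can be read with the tag `t`: a quorum of servers has
coded elements for `t`, and no server has one that is not the coded element of `v`. -/
structure Recoverable (R : Execution P) (t : Tag₀ N) (v : Fin k → A) (n : ℕ) : Prop where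
  isVersion : R.IsVersion n t v
  exists_quorum : ∃ Q, IsQuorum k e Q ∧ ∀ j ∈ Q, ∀ p ≥ n,
    storedWord ((R.state p).server j).store (P.code P.v₀ j) t ≠ none
  storedWord_eq : ∀ j, ∀ p ≥ n,
    ∀ w ∈ storedWord ((R.state p).server j).store (P.code P.v₀ j) t, w = P.code v j

theorem recoverable_bot (hN : k + 2 * e ≤ N) : R.Recoverable ⊥ P.v₀ n where
  isVersion := Or.inl ⟨rfl, rfl⟩
  exists_quorum := by
    refine ⟨Finset.univ, ?_, fun j _ p _ => Option.some_ne_none _⟩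
    rw [IsQuorum, Finset.card_univ, Fintype.card_fin]
    omega
  storedWord_eq _ _ _ _ hw := (Option.some.inj hw).symm

theorem PreWritten.recoverable (hk : 1 ≤ k) (hR : (R.state 0).Fresh) {τ : Tag N}
    (h : R.PreWritten τ v n) : R.Recoverable τ v n where
  isVersion := h.isVersion
  exists_quorum := by
    obtain ⟨p₀, hp₀, Q, hQ, hword, -⟩ := h.quorum
    exact ⟨Q, hQ, fun j hj p hp =>
      ((hword j hj).of_persists (R.persists (hp₀.trans hp) j)).storedWord_ne_none _⟩
  storedWord_eq j p hp _ hw := ((h.mono hk hR hp).carries.store j).eq_of_mem_storedWord hw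

theorem exists_recoverable (hk : 1 ≤ k) (hN : k + 2 * e ≤ N) (hR : (R.state 0).Fresh)
    (hc : (R.state n).client i = .finalizeR t acks)
    (ht : ∀ τ : Tag N, t = τ → ∃ m ≤ n, ¬ (R.state m).HasTag τ) :
    ∃ v, R.Recoverable t v n := by
  cases t using WithBot.recBotCoe with
  | bot => exact ⟨_, recoverable_bot hN⟩
  | coe τ =>
    obtain ⟨m, hmn, hm⟩ := ht τ rfl
    have hn : ¬ (R.state n).Unfinalized τ := fun hn =>
      hn.client (i := i) (j := i) (q := .finalize .reader τ) (by rw [hc]; rfl) rfl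
    obtain ⟨v, hv⟩ := exists_preWritten hk hR hm hmn hn
    exact ⟨v, hv.recoverable hk hR⟩

theorem exists_storedWord_of_ack (hR : (R.state 0).Fresh)
    (hcalls : (R.state m).calls i < (R.state n).calls i)
    (hc : (R.state n).client i = .finalizeR t acks) (hj : j ∈ ackSet acks) :
    ∃ p > m,
      (j ∉ P.malicious →
        ackWord t acks j = storedWord ((R.state p).server j).store (P.code P.v₀ j) t) ∧
      (storedWord ((R.state p).server j).store (P.code P.v₀ j) t ≠ none →
        ackWord t acks j ≠ none) := by
  obtain ⟨r, hr⟩ := mem_ackSet.1 hj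
  obtain ⟨p, hmp, -, ⟨htag, hcorrect, hword⟩, hstore⟩ :=
    exists_handled (q := .finalize .reader t) hR hcalls (by rw [hc]; rfl)
      (Or.inl (by rw [hc]; exact hr))
  have hack : ackWord t acks j = r.word := by
    have htag : r.tag = t := htag
    simp [ackWord, hr, htag]
  rw [hack]
  refine ⟨p + 1, by omega, ?_, ?_⟩ <;> rw [hstore]
  · exact hcorrect
  · exact hword

theorem Recoverable.le_card_received (h : R.Recoverable t v (m + 1)) (hR : (R.state 0).Fresh)
    (hcalls : (R.state m).calls i < (R.state n).calls i)
    (hc : (R.state n).client i = .finalizeR t acks) (hacks : IsQuorum k e (ackSet acks)) :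
    k + 2 * e ≤ (received (ackWord t acks)).card := by
  obtain ⟨Q, hQ, hword⟩ := h.exists_quorum
  refine (hacks.le_card_inter hQ).trans (Finset.card_le_card fun j hj => mem_received.2 ?_)
  obtain ⟨hjacks, hjQ⟩ := Finset.mem_inter.1 hj
  obtain ⟨p, hmp, -, hne⟩ := exists_storedWord_of_ack hR hcalls hc hjacks
  exact hne (hword j hjQ p hmp)

theorem Recoverable.card_received_le (h : R.Recoverable t v (m + 1)) (hR : (R.state 0).Fresh)
    (hmal : P.malicious.card ≤ e) (hcalls : (R.state m).calls i < (R.state n).calls i)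
    (hc : (R.state n).client i = .finalizeR t acks) :
    (received (ackWord t acks)).card ≤ (matching P.code (ackWord t acks) v).card + e := by
  refine CAS.card_received_le hmal fun j hj w hw => ?_
  obtain ⟨r, hr, -⟩ := Option.bind_eq_some_iff.1 hw
  obtain ⟨p, hmp, heq, -⟩ := exists_storedWord_of_ack hR hcalls hc (mem_ackSet.2 ⟨r, hr⟩)
  exact h.storedWord_eq j p hmp w (heq hj ▸ hw)

theorem LegalFrom.fresh (h : R.LegalFrom n) : (R.state 0).Fresh :=
  h.elim (fun h => h.2.1.fresh) fun h => h.1.fresh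

theorem LegalFrom.exists_not_hasTag (hlegal : R.LegalFrom n) (hk : 1 ≤ k) (hna : n ≤ a)
    {c : ℕ} (hcalls : (R.state a).calls i < (R.state c).calls i)
    (hc : (R.state c).client i = .query .read acks) (hacks : IsQuorum k e (ackSet acks))
    {τ : Tag N} (hτ : maxTag acks = τ) : ∃ m ≤ a, ¬ (R.state m).HasTag τ := by
  have hR := hlegal.fresh
  rcases hlegal with ⟨-, hsafe⟩ |
    ⟨-, i', a', b', t, ⟨⟨v, hop⟩, ⟨acks', hb'⟩, m, hma, hmax⟩, rfl⟩
  · exact ⟨0, Nat.zero_le _, hsafe.not_hasTag τ⟩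
  obtain ⟨Q, hQ, hfin⟩ := exists_quorum_finalized hR hop hb'
  have hle : (t : Tag₀ N) ≤ τ :=
    hτ ▸ le_maxTag_of_quorum hR hk hc hcalls hacks hQ fun j hj =>
      (hfin j hj).trans ((R.persists (by omega) j).maxPhase_le .reader)
  by_contra! hall
  have hab' := hop.1
  exact (hmax τ (hall 0 a.zero_le) (hall m (by omega))).not_ge (WithBot.coe_le_coe.1 hle)

theorem CompleteOp.read_returns (h : R.CompleteOp i .read a b) (hlegal : R.LegalFrom n)
    (hna : n ≤ a) (hcode : IsMDS P.code) (hmal : P.malicious.card ≤ e) (hk : 1 ≤ k)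
    (hN : k + 2 * e ≤ N) :
    ∃ (t : Tag₀ N) (acks : Acks N A) (v : Fin k → A),
      (R.state b).client i = .finalizeR t acks ∧
      R.IsVersion b t v ∧
      k ≤ (matching P.code (ackWord t acks) v).card ∧
      k + 2 * e ≤ (received (ackWord t acks)).card ∧
      (received (ackWord t acks)).card ≤ (matching P.code (ackWord t acks) v).card + e ∧
      (R.state (b + 1)).client i = .idle (some v) := by
  have hR := hlegal.fresh
  obtain ⟨c, acks₀, acks, hac, hcb, hc, hQ₀, hc', hb, hQ, hreturn⟩ := h.exists_finalizeR
  obtain ⟨v, hv⟩ := exists_recoverable hk hN hR hc' fun τ hτ =>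
    let ⟨m, hma, hm⟩ :=
      hlegal.exists_not_hasTag hk hna (calls_lt_of_invoke h.2.1 hac) hc hQ₀ hτ
    ⟨m, by omega, hm⟩
  have hcalls : (R.state c).calls i < (R.state b).calls i :=
    (R.calls_mono i hcb.le).lt_of_ne fun heq => by
      have hrequest := request_eq_of_calls_eq hcb.le heq i
      rw [hb, hc] at hrequest
      cases hrequest
  have hreceived := hv.le_card_received hR hcalls hb hQ
  have hmatching := hv.card_received_le hR hmal hcalls hb
  exact ⟨_, acks, v, hb, hv.isVersion.mono hcb, by omega, hreceived, hmatching,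
    by rw [hreturn, decode_eq_some hcode hreceived hmatching]⟩

end Execution

end Operations

/-! ### Termination -/

section Termination

variable {N k e : ℕ} {A : Type} {P : Params N k e A} {s s' : State N k A} {l : Label N k A}
  {i j : Fin N}

/-- The step by which the token between client `i` and server `j` leaves its position. -/
def exitLabel (k : ℕ) (i j : Fin N) : Wire N A → Label N k A
  | .atClient => .pingDepart i j
  | .toServer _ => .pingArrive i j
  | .atServer => .pongDepart i j
  | .toClient _ => .pongArrive i j

theorem exitLabel_isAlgorithmStep (w : Wire N A) : (exitLabel k i j w).IsAlgorithmStep := by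
  cases w <;> trivial

theorem State.exists_step_exitLabel (P : Params N k e A) (s : State N k A)
    (hi : i ∉ s.deadClients) (hj : j ∉ s.deadServers) :
    ∃ s', Step P s (exitLabel k i j (s.wire i j)) s' := by
  rcases hw : s.wire i j with _ | (_ | ⟨n, q⟩) | _ | m
  · exact ⟨_, .pingDepart s i j hi hw⟩
  · exact ⟨_, .pingArriveEmpty s i j hj hw⟩
  · exact ⟨_, .pingArrive s i j n q _ hj hw ⟨rfl, fun _ => rfl, id⟩⟩
  · exact ⟨_, .pongDepart s i j hj hw⟩
  · by_cases hm : ∃ r, m = some (s.calls i, r)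
    · obtain ⟨r, rfl⟩ := hm
      exact ⟨_, .pongArrive s i j r hi hw⟩
    · exact ⟨_, .pongArriveOther s i j m hi hw (not_exists.1 hm)⟩

theorem Step.wire_eq_of_ne_exitLabel (h : Step P s l s')
    (hl : l ≠ exitLabel k i j (s.wire i j)) :
    s'.wire i j = s.wire i j ∧ (s'.server j).pongTx i = (s.server j).pongTx i := by
  cases h.token i j with
  | unchanged wire' buffer => exact ⟨wire', buffer⟩
  | _ => simp_all [exitLabel]

theorem Step.of_pingDepart (h : Step P s (.pingDepart i j) s') :
    s'.wire i j = .toServer (((s.client i).request j).map fun q => (s.calls i, q)) := by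
  cases h with
  | pingDepart => simp [State.setWire_wire]

theorem Step.of_pingArrive (h : Step P s (.pingArrive i j) s') :
    s'.wire i j = .atServer ∧ ∀ n q, s.wire i j = .toServer (some (n, q)) →
      ∃ r, (s'.server j).pongTx i = some (n, r) := by
  cases h with
  | pingArriveEmpty _ _ _ wire => exact ⟨by simp [State.setWire_wire], by simp [wire]⟩
  | pingArrive _ _ _ _ r _ wire =>
    refine ⟨by simp [State.setWire_wire], fun n q hw => ?_⟩
    cases wire.symm.trans hw
    exact ⟨r, (State.setPong_pongTx ..).trans (if_pos ⟨rfl, rfl⟩)⟩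

theorem Step.of_pongDepart (h : Step P s (.pongDepart i j) s') :
    s'.wire i j = .toClient ((s.server j).pongTx i) := by
  cases h with
  | pongDepart => simp [State.setWire_wire]

theorem Step.of_pongArrive (h : Step P s (.pongArrive i j) s') :
    s'.wire i j = .atClient ∧ ∀ r, s.wire i j = .toClient (some (s.calls i, r)) →
      s'.client i = (s.client i).addAck j r := by
  cases h with
  | pongArrive _ _ _ _ wire =>
    refine ⟨by simp [State.setWire_wire], fun r hw => ?_⟩
    cases wire.symm.trans hw
    exact Function.update_self ..
  | pongArriveOther _ _ _ _ wire hm =>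
    exact ⟨by simp [State.setWire_wire],
      fun r hw => absurd (Wire.toClient.inj (wire.symm.trans hw)) (hm r)⟩

theorem Client.acks_addAck_self {c : Client N k A} (hc : ¬ c.Idle) (j : Fin N) (r : Reply N A) :
    (c.addAck j r).acks j = some r := by
  cases c <;> first | exact absurd trivial hc | exact Function.update_self ..

theorem Client.ackSet_subset_addAck (c : Client N k A) (j : Fin N) (r : Reply N A) :
    ackSet c.acks ⊆ ackSet (c.addAck j r).acks := by
  intro j' hj'
  by_cases hc : c.Idle
  · cases c <;> first | exact hj' | exact hc.elim
  by_cases hj : j' = j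
  · subst hj
    exact mem_ackSet.2 ⟨r, c.acks_addAck_self hc j' r⟩
  · rw [mem_ackSet] at hj' ⊢
    cases c <;>
      first | exact absurd trivial hc | simpa [Client.addAck, Client.acks, hj] using hj'

theorem Client.exists_request {c : Client N k A} (hc : ¬ c.Idle) (j : Fin N) :
    ∃ q, c.request j = some q := by
  cases c <;> first | exact absurd trivial hc | exact ⟨_, rfl⟩

/-- The number of calls of `qrmAccess` that the current procedure may still have to complete. -/
def Client.remaining : Client N k A → ℕ
  | .idle _ => 0
  | .query _ _ => 4
  | .prewrite _ _ _ => 3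
  | .finalizeW _ _ => 2
  | .finalizeAgainW _ _ => 1
  | .finalizeR _ _ => 1

theorem Client.remaining_advance_lt {c : Client N k A} (hc : ¬ c.Idle) (i : Fin N) :
    (c.advance P i).remaining < c.remaining := by
  rcases c with _ | ⟨_ | _, _⟩ | _ | _ | _ | _ <;>
    first | exact absurd trivial hc | simp [Client.advance, Client.remaining]

theorem Client.remaining_addAck (c : Client N k A) (j : Fin N) (r : Reply N A) :
    (c.addAck j r).remaining = c.remaining := by
  cases c <;> rfl

theorem Step.ackSet_subset (h : Step P s l s') (hn : s'.calls i = s.calls i) :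
    ackSet (s.client i).acks ⊆ ackSet (s'.client i).acks := by
  rcases h.client i with ⟨hc, -⟩ | ⟨j, r, _, hc, -⟩ | ⟨_, _, _, _, hn'⟩ | ⟨_, _, _, _, hn'⟩
  · rw [hc]
  · rw [hc]
    exact Client.ackSet_subset_addAck _ j r
  all_goals omega

theorem Step.busy_of_ne_advance (h : Step P s l s') (hl : l ≠ .advance i)
    (hbusy : ¬ (s.client i).Idle) :
    ¬ (s'.client i).Idle ∧ s'.calls i = s.calls i ∧
      (s'.client i).remaining = (s.client i).remaining := by
  rcases h.client i with ⟨hc, hn⟩ | ⟨_, _, _, hc, hn⟩ | ⟨hl', _, _, _, _⟩ | ⟨_, _, hidle, _, _⟩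
  · rw [hc]
    exact ⟨hbusy, hn, rfl⟩
  · rw [hc, Client.idle_addAck, Client.remaining_addAck]
    exact ⟨hbusy, hn, rfl⟩
  · exact absurd hl' hl
  · exact absurd hidle hbusy

theorem Step.deadServers_subset (h : Step P s l s') : s.deadServers ⊆ s'.deadServers := by
  cases h with
  | crashServer => exact Finset.subset_insert _ _
  | _ => exact subset_rfl

namespace Execution

variable {R : Execution P} {f n : ℕ}

theorem Fair.exists_label_eq (hfair : R.Fair) (hl : l.IsAlgorithmStep) {I : State N k A → Prop}
    (hn : I (R.state n))
    (hstep : ∀ m ≥ n, I (R.state m) → R.label m ≠ l → I (R.state (m + 1)))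
    (henabled : (∀ m ≥ n, I (R.state m)) →
      ∀ᶠ m in Filter.atTop, ∃ s' : State N k A, Step P (R.state m) l s') :
    ∃ m ≥ n, R.label m = l ∧ I (R.state m) := by
  by_contra! hne
  have hI : ∀ m ≥ n, I (R.state m) := fun m hm => by
    induction m, hm using Nat.le_induction with
    | base => exact hn
    | succ m hm ih => exact hstep m hm ih fun hlm => hne m hm hlm ih
  obtain ⟨m, hm, hlm⟩ := Filter.frequently_atTop.1 (hfair l hl (henabled hI).frequently) n
  exact hne m hm hlm (hI m hm)

open Classical in
/-- The servers that never fail. -/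
noncomputable def correctServers (R : Execution P) : Finset (Fin N) :=
  Finset.univ.filter fun j => ∀ n, j ∉ (R.state n).deadServers

theorem mem_correctServers : j ∈ R.correctServers ↔ ∀ n, j ∉ (R.state n).deadServers := by
  simp [correctServers]

theorem eventually_mem_deadServers (hj : j ∉ R.correctServers) :
    ∀ᶠ n in Filter.atTop, j ∈ (R.state n).deadServers := by
  simp only [mem_correctServers, not_forall, not_not] at hj
  obtain ⟨n, hn⟩ := hj
  have hmono : Monotone fun n => (R.state n).deadServers :=
    monotone_nat_of_le_succ fun n => (R.step n).deadServers_subset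
  exact Filter.eventually_atTop.2 ⟨n, fun m hm => hmono hm hn⟩

theorem isQuorum_correctServers (hN : k + 2 * (f + e) ≤ N)
    (hf : ∀ n, (R.state n).deadServers.card ≤ f) : IsQuorum k e R.correctServers := by
  obtain ⟨n, hn⟩ := ((Filter.eventually_all_finset R.correctServersᶜ).2 fun j hj =>
    eventually_mem_deadServers (Finset.mem_compl.1 hj)).exists
  have hcompl := (Finset.card_le_card hn).trans (hf n)
  have hsum := Finset.card_add_card_compl R.correctServers
  rw [Fintype.card_fin] at hsum
  unfold IsQuorum
  omega

theorem exists_exit (hfair : R.Fair) (hi : ∀ n, i ∉ (R.state n).deadClients)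
    (hj : j ∈ R.correctServers) (n : ℕ) :
    ∃ m ≥ n, R.label m = exitLabel k i j ((R.state n).wire i j) ∧
      (R.state m).wire i j = (R.state n).wire i j ∧
      ((R.state m).server j).pongTx i = ((R.state n).server j).pongTx i := by
  refine hfair.exists_label_eq (exitLabel_isAlgorithmStep _)
    (I := fun s => s.wire i j = (R.state n).wire i j ∧
      (s.server j).pongTx i = ((R.state n).server j).pongTx i) ⟨rfl, rfl⟩ ?_ ?_
  · rintro m - ⟨hw, hbuffer⟩ hl
    obtain ⟨hw', hbuffer'⟩ := (R.step m).wire_eq_of_ne_exitLabel (hw ▸ hl)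
    exact ⟨hw'.trans hw, hbuffer'.trans hbuffer⟩
  · refine fun hI => Filter.eventually_atTop.2 ⟨n, fun m hm => ?_⟩
    rw [← (hI m hm).1]
    exact (R.state m).exists_step_exitLabel P (hi m) (mem_correctServers.1 hj m)

theorem exists_toServer (hfair : R.Fair) (hi : ∀ n, i ∉ (R.state n).deadClients)
    (hj : j ∈ R.correctServers) (hw : (R.state n).wire i j = .atClient) :
    ∃ m ≥ n, (R.state (m + 1)).wire i j =
      .toServer ((((R.state m).client i).request j).map fun q => ((R.state m).calls i, q)) := by
  obtain ⟨m, hm, hl, -, -⟩ := exists_exit hfair hi hj n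
  rw [hw] at hl
  exact ⟨m, hm, (step_of_label_eq hl).of_pingDepart⟩

theorem exists_atServer (hfair : R.Fair) (hi : ∀ n, i ∉ (R.state n).deadClients)
    (hj : j ∈ R.correctServers) {x : Option (ℕ × Request N A)}
    (hw : (R.state n).wire i j = .toServer x) :
    ∃ m ≥ n, (R.state m).wire i j = .atServer ∧ ∀ c q, x = some (c, q) →
      ∃ r, ((R.state m).server j).pongTx i = some (c, r) := by
  obtain ⟨m, hm, hl, hw', -⟩ := exists_exit hfair hi hj n
  rw [hw] at hl hw'
  obtain ⟨hserver, hreply⟩ := (step_of_label_eq hl).of_pingArrive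
  exact ⟨m + 1, by omega, hserver, fun c q hx => hreply c q (hx ▸ hw')⟩

theorem exists_toClient (hfair : R.Fair) (hi : ∀ n, i ∉ (R.state n).deadClients)
    (hj : j ∈ R.correctServers) (hw : (R.state n).wire i j = .atServer) :
    ∃ m ≥ n, (R.state m).wire i j = .toClient (((R.state n).server j).pongTx i) := by
  obtain ⟨m, hm, hl, -, hbuffer⟩ := exists_exit hfair hi hj n
  rw [hw] at hl
  exact ⟨m + 1, by omega,
    hbuffer ▸ (step_of_label_eq hl).of_pongDepart⟩

theorem exists_atClient_of_toClient (hfair : R.Fair) (hi : ∀ n, i ∉ (R.state n).deadClients)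
    (hj : j ∈ R.correctServers) {x : Option (ℕ × Reply N A)}
    (hw : (R.state n).wire i j = .toClient x) :
    ∃ m ≥ n, (R.state (m + 1)).wire i j = .atClient ∧ ∀ r, x = some ((R.state m).calls i, r) →
      (R.state (m + 1)).client i = ((R.state m).client i).addAck j r := by
  obtain ⟨m, hm, hl, hw', -⟩ := exists_exit hfair hi hj n
  rw [hw] at hl hw'
  obtain ⟨hclient, hack⟩ := (step_of_label_eq hl).of_pongArrive
  exact ⟨m, hm, hclient, fun r hx => hack r (hx ▸ hw')⟩

theorem exists_atClient (hfair : R.Fair) (hi : ∀ n, i ∉ (R.state n).deadClients)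
    (hj : j ∈ R.correctServers) (n : ℕ) : ∃ m ≥ n, (R.state m).wire i j = .atClient := by
  have of_toClient : ∀ n x, (R.state n).wire i j = .toClient x →
      ∃ m ≥ n, (R.state m).wire i j = .atClient := fun n x hw =>
    let ⟨m, hm, hw', _⟩ := exists_atClient_of_toClient hfair hi hj hw
    ⟨m + 1, by omega, hw'⟩
  have of_atServer : ∀ n, (R.state n).wire i j = .atServer →
      ∃ m ≥ n, (R.state m).wire i j = .atClient := fun n hw =>
    let ⟨m, hm, hw'⟩ := exists_toClient hfair hi hj hw
    let ⟨p, hp, hw''⟩ := of_toClient m _ hw'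
    ⟨p, hm.trans hp, hw''⟩
  rcases hw : (R.state n).wire i j with _ | _ | _ | _
  · exact ⟨n, le_rfl, hw⟩
  · obtain ⟨m, hm, hw', -⟩ := exists_atServer hfair hi hj hw
    obtain ⟨p, hp, hw''⟩ := of_atServer m hw'
    exact ⟨p, hm.trans hp, hw''⟩
  · exact of_atServer n hw
  · exact of_toClient n _ hw

theorem exists_mem_ackSet (hfair : R.Fair) (hi : ∀ n, i ∉ (R.state n).deadClients)
    (hj : j ∈ R.correctServers) (hbusy : ∀ m ≥ n, ¬ ((R.state m).client i).Idle)
    (hcalls : ∀ m ≥ n, (R.state m).calls i = (R.state n).calls i) :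
    ∃ m ≥ n, j ∈ ackSet ((R.state m).client i).acks := by
  obtain ⟨m₀, hm₀, hclient⟩ := exists_atClient hfair hi hj n
  obtain ⟨m₁, hm₁, hping⟩ := exists_toServer hfair hi hj hclient
  obtain ⟨q, hq⟩ := Client.exists_request (hbusy m₁ (by omega)) j
  obtain ⟨m₂, hm₂, hserver, hbuffer⟩ := exists_atServer hfair hi hj hping
  obtain ⟨r, hr⟩ := hbuffer _ q (by rw [hq]; rfl)
  obtain ⟨m₃, hm₃, hpong⟩ := exists_toClient hfair hi hj hserver
  obtain ⟨m₄, hm₄, -, hack⟩ := exists_atClient_of_toClient hfair hi hj hpong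
  have hcall : (R.state m₁).calls i = (R.state m₄).calls i := by
    rw [hcalls m₁ (by omega), hcalls m₄ (by omega)]
  refine ⟨m₄ + 1, by omega, mem_ackSet.2 ⟨r, ?_⟩⟩
  rw [hack r (hcall ▸ hr)]
  exact Client.acks_addAck_self (hbusy m₄ (by omega)) j r

theorem eventually_mem_ackSet (hfair : R.Fair) (hi : ∀ n, i ∉ (R.state n).deadClients)
    (hj : j ∈ R.correctServers) (hbusy : ∀ m ≥ n, ¬ ((R.state m).client i).Idle)
    (hcalls : ∀ m ≥ n, (R.state m).calls i = (R.state n).calls i) :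
    ∀ᶠ m in Filter.atTop, j ∈ ackSet ((R.state m).client i).acks := by
  obtain ⟨m, hm, hjm⟩ := exists_mem_ackSet hfair hi hj hbusy hcalls
  refine Filter.eventually_atTop.2 ⟨m, fun p hp => ?_⟩
  induction p, hp using Nat.le_induction with
  | base => exact hjm
  | succ p hp ih =>
    refine (R.step p).ackSet_subset ?_ ih
    rw [hcalls p (by omega), hcalls (p + 1) (by omega)]

theorem exists_advance (hfair : R.Fair) (hN : k + 2 * (f + e) ≤ N)
    (hf : ∀ n, (R.state n).deadServers.card ≤ f) (hi : ∀ n, i ∉ (R.state n).deadClients)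
    (hn : ¬ ((R.state n).client i).Idle) :
    ∃ m ≥ n, R.label m = .advance i ∧ ¬ ((R.state m).client i).Idle ∧
      ((R.state m).client i).remaining = ((R.state n).client i).remaining := by
  obtain ⟨m, hm, hl, hbusy, -, hremaining⟩ := hfair.exists_label_eq
    (l := .advance i) trivial
    (I := fun s => ¬ (s.client i).Idle ∧ s.calls i = (R.state n).calls i ∧
      (s.client i).remaining = ((R.state n).client i).remaining) ⟨hn, rfl, rfl⟩
    (by
      rintro m - ⟨hbusy, hcalls, hremaining⟩ hl
      obtain ⟨hbusy', hcalls', hremaining'⟩ := (R.step m).busy_of_ne_advance hl hbusy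
      exact ⟨hbusy', hcalls'.trans hcalls, hremaining'.trans hremaining⟩)
    (by
      intro hI
      have hacks : ∀ᶠ m in Filter.atTop,
          ∀ j ∈ R.correctServers, j ∈ ackSet ((R.state m).client i).acks :=
        (Filter.eventually_all_finset _).2 fun j hj =>
          eventually_mem_ackSet hfair hi hj (fun m hm => (hI m hm).1) fun m hm => (hI m hm).2.1
      filter_upwards [hacks, Filter.eventually_ge_atTop n] with m hacks hm
      exact ⟨_, .advance _ i (hi m) (hI m hm).1 ((isQuorum_correctServers hN hf).mono hacks)⟩)
  exact ⟨m, hm, hl, hbusy, hremaining⟩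

theorem exists_idle (hfair : R.Fair) (hN : k + 2 * (f + e) ≤ N)
    (hf : ∀ n, (R.state n).deadServers.card ≤ f) (hi : ∀ n, i ∉ (R.state n).deadClients)
    (hn : ¬ ((R.state n).client i).Idle) :
    ∃ b ≥ n, ((R.state (b + 1)).client i).Idle := by
  induction hr : ((R.state n).client i).remaining using Nat.strong_induction_on generalizing n with
  | _ x ih =>
    obtain ⟨m, hm, hl, hbusy, hremaining⟩ := exists_advance hfair hN hf hi hn
    by_cases hidle : ((R.state (m + 1)).client i).Idle
    · exact ⟨m, hm, hidle⟩
    · have hlt := Client.remaining_advance_lt (P := P) hbusy i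
      obtain ⟨-, hclient, -⟩ := (step_of_label_eq hl).of_advance
      rw [← hclient, hremaining, hr] at hlt
      obtain ⟨b, hb, hidle⟩ := ih _ hlt hidle rfl
      exact ⟨b, by omega, hidle⟩

end Execution

end Termination

end CAS

theorem mainTheorem4 (N k e f : ℕ) (A : Type) (P : CAS.Params N k e A)
    (hcode : CAS.IsMDS P.code) (hmal : P.malicious.card ≤ e)
    (hk : 1 ≤ k) (hkN : k + 2 * (f + e) ≤ N)
    (R : CAS.Execution P) (n₀ : ℕ)
    (hlegal : R.LegalFrom n₀) (hfair : R.Fair)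
    (hf : ∀ n, (R.state n).deadServers.card ≤ f) :
    (∀ (i : Fin N) (n : ℕ), n₀ ≤ n → ¬ ((R.state n).client i).Idle →
      (∀ m, i ∉ (R.state m).deadClients) → ∃ b, n ≤ b ∧ ((R.state (b + 1)).client i).Idle) ∧
    (∀ (i : Fin N) (a b : ℕ), n₀ ≤ a → R.CompleteOp i .read a b →
      ∃ (t : CAS.Tag₀ N) (acks : CAS.Acks N A) (v : Fin k → A),
        (R.state b).client i = .finalizeR t acks ∧
        R.IsVersion b t v ∧
        k ≤ (CAS.matching P.code (CAS.ackWord t acks) v).card ∧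
        k + 2 * e ≤ (CAS.received (CAS.ackWord t acks)).card ∧
        (CAS.received (CAS.ackWord t acks)).card ≤
          (CAS.matching P.code (CAS.ackWord t acks) v).card + e ∧
        (R.state (b + 1)).client i = .idle (some v)) := by
  refine ⟨fun i n _ hbusy hi => CAS.Execution.exists_idle hfair hkN hf hi hbusy,
    fun i a b ha hread => ?_⟩
  exact hread.read_returns hlegal ha hcode hmal hk (by omega)
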